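/- **Setting.** For $d\in\mathbb N$ let $D_d\subset\mathbb R^d$ be a Borel set of positive Lebesgue measure, $\rho_d$ a probability density on $D_d$, $G_d=L_2(D_d,\rho_d(x)\,dx)$, and $F_d$ a separable (real or complex) Hilbert space of functions on $D_d$ such that $\mathrm{APP}_d:F_d\to G_d$, $\mathrm{APP}_d f=f$, is a compact embedding. Let $\Lambda^{\rm all}$ be the class of all linear functionals on $F_d$ (not necessarily continuous) and $\Lambda^{\rm std}$ the class of all function values $f\mapsto f(x)$, $x\in D_d$; these are not assumed to be continuous on $F_d$. Below, $\mathbb K$ is the scalar field. *Worst case setting.* $e^{\rm wor}(0,d;\Lambda^{\rm all})=\sup_{\|f\|_{F_d}\le1}\|f\|_{G_d}$ and, for $n\ge1$, $$e^{\rm wor}(n,d;\Lambda^{\rm all})=\inf_{L_1,\dots,L_n\in\Lambda^{\rm all},\ \phi}\ \sup_{\|f\|_{F_d}\le1}\|f-\phi(L_1(f),\dots,L_n(f))\|_{G_d},$$ where $\phi:\mathbb K^n\to G_d$ runs over all measurable maps. *Randomized setting.* A randomized algorithm using $\Lambda^{\rm std}$ is a family $A^\omega(f)=\phi_\omega(L_{1,\omega}(f),\dots,L_{n,\omega}(f))$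 with $L_{j,\omega}\in\Lambda^{\rm std}$ and $\phi_\omega$ measurable, where $\omega$ is drawn from a probability space and the number $n=n(f,\omega)$ may be random and may be determined adaptively by a stopping rule based on the values already computed. Its cardinality is $\sup_{\|f\|_{F_d}\le1}\mathbb E_\omega\,n(f,\omega)$ and its error is $\sup_{\|f\|_{F_d}\le1}(\mathbb E_\omega\|f-A^\omega(f)\|_{G_d}^2)^{1/2}$. For $n\ge1$, $e^{\rm ran}(n,d;\Lambda^{\rm std})$ is the infimum of the errors of all such algorithms of cardinality at most $n$, and $e^{\rm ran}(0,d;\Lambda^{\rm std})=\sup_{\|f\|_{F_d}\le1}\|f\|_{G_d}$. *Information complexity.* For $\diamond\in\{\mathrm{wor},\mathrm{ran}\}$, $\star\in\{\mathrm{ABS},\mathrm{NOR}\}$ and $\varepsilon>0$, $$n^{\diamond,\star}(\varepsilon,d;\Lambda)=\inf\{n\in\{0,1,2,\dots\}: e^{\diamond}(n,d;\Lambda)\le\varepsilon\,\mathrm{CRI}_d\},$$ where $\mathrm{CRI}_d=1$ for $\star=\mathrm{ABS}$ and $\mathrm{CRI}_d=e^{\diamond}(0,d;\Lambda)$ for $\star=\mathrm{NOR}$.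 **Corollary 2.4.** (1) For every $\omega>0$, $$C_\omega:=\sup_{x\ge1}\frac{96\sqrt2\,(\ln x+\ln(192\sqrt2))}{x^\omega}<\infty,$$ and for all $d$, all such problems $\mathrm{APP}_d$, both $\star\in\{\mathrm{ABS},\mathrm{NOR}\}$ and all $\varepsilon>0$, $$n^{\mathrm{ran},\star}(\varepsilon,d;\Lambda^{\rm std})\le C_\omega\bigl(n^{\mathrm{wor},\star}(\tfrac{\varepsilon}{4},d;\Lambda^{\rm all})+1\bigr)^{1+\omega}.$$ (2) For $\delta\in(0,1)$ put $A_\delta=\bigl(1+\frac1{12\ln(1/\delta)}\bigr)^{1/2}\frac1{\sqrt{1-\delta}}$. There is $\delta_0\in(0,1)$ such that for all $\delta\in(0,\delta_0)$ and all $\omega>0$, $$C_{\omega,\delta}:=\sup_{x\ge1}\frac{48\bigl(4(\ln48+\ln\ln\frac1\delta+\ln x)+\ln\frac1\delta\bigr)}{x^\omega}<\infty,$$ and for all $d$, all such problems $\mathrm{APP}_d$, both $\star\in\{\mathrm{ABS},\mathrm{NOR}\}$ and all $\varepsilon>0$, $$n^{\mathrm{ran},\star}(\varepsilon,d;\Lambda^{\rm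 std})\le C_{\omega,\delta}\bigl(n^{\mathrm{wor},\star}(\tfrac{\varepsilon}{A_\delta},d;\Lambda^{\rm all})+1\bigr)^{1+\omega}.$$ -/

import Mathlib

open MeasureTheory
open scoped ENNReal

universe u v

/-- The linear map `f ↦ [T f]` into `L₂(μ)`, for a linear map `T` from a vector space `F` into
functions on `X`, all of whose values are square integrable. -/
noncomputable def toL2 {𝕜 : Type v} [RCLike 𝕜] {X : Type*} [MeasurableSpace X] {F : Type u}
    [AddCommGroup F] [Module 𝕜 F] (μ : Measure X) (T : F →ₗ[𝕜] (X → 𝕜))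
    (hT : ∀ f, MemLp (T f) 2 μ) : F →ₗ[𝕜] Lp 𝕜 2 μ where
  toFun f := (hT f).toLp (T f)
  map_add' f g := by
    rw [← MemLp.toLp_add (hT f) (hT g)]
    exact MemLp.toLp_congr _ _ (by rw [map_add])
  map_smul' c f := by
    rw [RingHom.id_apply, ← MemLp.toLp_const_smul c (hT f)]
    exact MemLp.toLp_congr _ _ (by rw [map_smul])

/-- The Lebesgue measure on a subset `D` of `ℝ^d`. -/
noncomputable def lebesgueOn {d : ℕ} (D : Set (EuclideanSpace ℝ (Fin d))) : Measure D :=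
  Measure.comap (Subtype.val : D → EuclideanSpace ℝ (Fin d)) volume

/-- The measure `ρ(x) dx` on `D`. -/
noncomputable def densityOn {d : ℕ} (D : Set (EuclideanSpace ℝ (Fin d))) (ρ : D → ℝ) : Measure D :=
  (lebesgueOn D).withDensity fun x => ENNReal.ofReal (ρ x)

/-- The approximation problem `APP_d : F_d → G_d`, `APP_d f = f`, for `d`-variate functions:
`F` is a separable Hilbert space of `𝕜`-valued functions on the Borel set `D ⊆ ℝ^d` of positive
Lebesgue measure, `ρ` is a probability density on `D`, `G_d = L₂(D, ρ(x) dx)`, and the embedding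
of `F` into `G_d` is compact. The functions in `F` are genuine functions, with a value at every
point of `D`; the evaluation functionals are not assumed to be continuous on `F`. -/
structure ApproxProblem (𝕜 : Type v) [RCLike 𝕜] (d : ℕ) where
  D : Set (EuclideanSpace ℝ (Fin d))
  measurableSet_D : MeasurableSet D
  volume_D_pos : 0 < volume D
  ρ : D → ℝ
  measurable_ρ : Measurable ρ
  ρ_nonneg : ∀ x, 0 ≤ ρ x
  lintegral_ρ : ∫⁻ x, ENNReal.ofReal (ρ x) ∂lebesgueOn D = 1
  F : Type u
  [normedAddCommGroup : NormedAddCommGroup F]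
  [innerProductSpace : InnerProductSpace 𝕜 F]
  [completeSpace : CompleteSpace F]
  [separableSpace : TopologicalSpace.SeparableSpace F]
  /-- the value `f(x)` of `f ∈ F` at `x ∈ D` is `eval f x` -/
  eval : F →ₗ[𝕜] (D → 𝕜)
  eval_injective : Function.Injective eval
  memLp_eval : ∀ f, MemLp (eval f) 2 (densityOn D ρ)
  isCompact_embedding : IsCompactOperator (toL2 (densityOn D ρ) eval memLp_eval)

namespace ApproxProblem

attribute [instance] normedAddCommGroup innerProductSpace completeSpace separableSpace

variable {𝕜 : Type v} [RCLike 𝕜] {d : ℕ}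

/-- The measure `ρ(x) dx` on `D`. -/
noncomputable def μ (P : ApproxProblem.{u} 𝕜 d) : Measure P.D :=
  densityOn P.D P.ρ

/-- The target space `G_d = L₂(D, ρ(x) dx)`. -/
abbrev G (P : ApproxProblem.{u} 𝕜 d) : Type v := Lp 𝕜 2 P.μ

/-- The embedding `APP_d : F → G`, `f ↦ f`. -/
noncomputable def app (P : ApproxProblem.{u} 𝕜 d) : P.F →ₗ[𝕜] P.G :=
  toL2 P.μ P.eval P.memLp_eval

/-- The class `Λ^all` of all linear functionals on `F`, continuous or not. -/
def allInfo (P : ApproxProblem.{u} 𝕜 d) : Set (P.F →ₗ[𝕜] 𝕜) := Set.univ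

/-- The class `Λ^std` of all function values `f ↦ f(x)`, `x ∈ D`. -/
def stdInfo (P : ApproxProblem.{u} 𝕜 d) : Set (P.F →ₗ[𝕜] 𝕜) :=
  {L | ∃ x : P.D, ∀ f, L f = P.eval f x}

/-- The initial error, that is, the error of the zero algorithm. -/
noncomputable def initialError (P : ApproxProblem.{u} 𝕜 d) : ℝ≥0∞ :=
  ⨆ (f : P.F) (_ : ‖f‖ ≤ 1), ‖P.app f‖ₑ

/-- The worst case error of the algorithm `f ↦ φ (L₁ f, …, Lₙ f)`. -/
noncomputable def worError (P : ApproxProblem.{u} 𝕜 d) {n : ℕ} (L : Fin n → (P.F →ₗ[𝕜] 𝕜))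
    (φ : (Fin n → 𝕜) → P.G) : ℝ≥0∞ :=
  ⨆ (f : P.F) (_ : ‖f‖ ≤ 1), ‖P.app f - φ (fun i => L i f)‖ₑ

/-- The `n`th minimal worst case error `e^wor(n, d; Λ)`: the infimum over all `L₁, …, Lₙ ∈ Λ` and
all measurable `φ : 𝕜ⁿ → G`; for `n = 0` only the zero algorithm is used. -/
noncomputable def worMinError (P : ApproxProblem.{u} 𝕜 d) (Λ : Set (P.F →ₗ[𝕜] 𝕜)) : ℕ → ℝ≥0∞
  | 0 => P.initialError
  | n + 1 => ⨅ (L : Fin (n + 1) → (P.F →ₗ[𝕜] 𝕜)) (_ : ∀ i, L i ∈ Λ)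
      (φ : (Fin (n + 1) → 𝕜) → P.G) (_ : StronglyMeasurable φ), P.worError L φ

open Classical in
/-- A randomized algorithm with information from `Λ`. An element `ω` of the probability space
`Ω` is drawn; then the values `L_{1,ω}(f), L_{2,ω}(f), …` are computed one after the other until,
for the first time, the vector of the `k` values computed so far lies in the halting set
`halt ω k`. This `k` is the cardinality `n(f, ω)`, and the output is
`φ_{k,ω}(L_{1,ω}(f), …, L_{k,ω}(f))`. -/
structure RandAlg (P : ApproxProblem.{u} 𝕜 d) (Λ : Set (P.F →ₗ[𝕜] 𝕜)) where
  Ω : Type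
  [measurableSpace : MeasurableSpace Ω]
  prob : Measure Ω
  [isProbabilityMeasure : IsProbabilityMeasure prob]
  L : Ω → ℕ → (P.F →ₗ[𝕜] 𝕜)
  L_mem : ∀ ω j, L ω j ∈ Λ
  halt : Ω → (k : ℕ) → Set (Fin k → 𝕜)
  measurableSet_halt : ∀ ω k, MeasurableSet (halt ω k)
  terminates : ∀ ω f, ∃ k, (fun i : Fin k => L ω i f) ∈ halt ω k
  φ : Ω → (k : ℕ) → (Fin k → 𝕜) → P.G
  measurable_φ : ∀ ω k, StronglyMeasurable (φ ω k)
  /-- `n(f, ω)` is a random variable for every `f` -/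
  aemeasurable_card : ∀ f, AEMeasurable (fun ω => Nat.find (terminates ω f)) prob
  /-- the output is a random element of `G` for every `f` -/
  aestronglyMeasurable_out : ∀ f, AEStronglyMeasurable
    (fun ω => φ ω (Nat.find (terminates ω f)) (fun i => L ω i f)) prob

namespace RandAlg

attribute [instance] measurableSpace isProbabilityMeasure

variable {P : ApproxProblem.{u} 𝕜 d} {Λ : Set (P.F →ₗ[𝕜] 𝕜)}

open Classical in
/-- The number `n(f, ω)` of information evaluations. -/
noncomputable def numEval (A : RandAlg P Λ) (f : P.F) (ω : A.Ω) : ℕ :=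
  Nat.find (A.terminates ω f)

/-- The output `A^ω(f)`. -/
noncomputable def out (A : RandAlg P Λ) (f : P.F) (ω : A.Ω) : P.G :=
  A.φ ω (A.numEval f ω) (fun i => A.L ω i f)

/-- The cardinality `sup_{‖f‖ ≤ 1} 𝔼 n(f, ω)`. -/
noncomputable def card (A : RandAlg P Λ) : ℝ≥0∞ :=
  ⨆ (f : P.F) (_ : ‖f‖ ≤ 1), ∫⁻ ω, (A.numEval f ω : ℝ≥0∞) ∂A.prob

/-- The randomized error `sup_{‖f‖ ≤ 1} (𝔼 ‖f - A^ω(f)‖²)^{1/2}`. -/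
noncomputable def error (A : RandAlg P Λ) : ℝ≥0∞ :=
  ⨆ (f : P.F) (_ : ‖f‖ ≤ 1), (∫⁻ ω, ‖P.app f - A.out f ω‖ₑ ^ 2 ∂A.prob) ^ (1 / 2 : ℝ)

end RandAlg

/-- The `n`th minimal randomized error `e^ran(n, d; Λ)`: the infimum over all randomized
algorithms of cardinality at most `n`; for `n = 0` only the zero algorithm is used. -/
noncomputable def ranMinError (P : ApproxProblem.{u} 𝕜 d) (Λ : Set (P.F →ₗ[𝕜] 𝕜)) : ℕ → ℝ≥0∞
  | 0 => P.initialError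
  | n + 1 => ⨅ (A : RandAlg P Λ) (_ : A.card ≤ ((n + 1 : ℕ) : ℝ≥0∞)), A.error

end ApproxProblem

/-- The absolute and the normalized error criterion. -/
inductive ErrorCriterion
  | ABS
  | NOR

/-- For a sequence `e` of minimal errors, the number `CRI`: it is `1` for the absolute criterion
and the initial error `e 0` for the normalized one. -/
def ErrorCriterion.cri (c : ErrorCriterion) (e : ℕ → ℝ≥0∞) : ℝ≥0∞ :=
  match c with
  | .ABS => 1
  | .NOR => e 0

/-- The information complexity `inf {n | e(n) ≤ ε CRI}` belonging to a sequence `e` of minimal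
errors; it is `∞` if there is no such `n`. -/
noncomputable def infoComplexity (e : ℕ → ℝ≥0∞) (c : ErrorCriterion) (ε : ℝ) : ℕ∞ :=
  ⨅ (n : ℕ) (_ : e n ≤ ENNReal.ofReal ε * c.cri e), (n : ℕ∞)

namespace ApproxProblem

variable {𝕜 : Type v} [RCLike 𝕜] {d : ℕ}

/-- `n^{wor,⋆}(ε, d; Λ^all)` -/
noncomputable def nWorAll (P : ApproxProblem.{u} 𝕜 d) (c : ErrorCriterion) (ε : ℝ) : ℕ∞ :=
  infoComplexity (P.worMinError P.allInfo) c ε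

/-- `n^{ran,⋆}(ε, d; Λ^std)` -/
noncomputable def nRanStd (P : ApproxProblem.{u} 𝕜 d) (c : ErrorCriterion) (ε : ℝ) : ℕ∞ :=
  infoComplexity (P.ranMinError P.stdInfo) c ε

end ApproxProblem

/-- `A_δ = (1 + 1 / (12 ln (1/δ)))^{1/2} (1 - δ)^{-1/2}` -/
noncomputable def constA (δ : ℝ) : ℝ :=
  √(1 + 1 / (12 * Real.log (1 / δ))) * (1 / √(1 - δ))

/-! Linear information of cardinality `n` with worst case error at most `r` forces the image of the
unit ball to lie within `r` of a subspace of `G` of dimension `m ≤ n`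
(`exists_submodule_norm_sub_le`). It remains to imitate the orthogonal projection onto that subspace
using function values. Write `f = ∑ aₖ bₖ + g` with `b` an orthonormal basis of the subspace and `g`
orthogonal to it. If random samples yield the `aₖ` with mean square error at most `q ‖g‖²`, then by
Pythagoras the total error is at most `√(1 + q) ‖g‖ ≤ √(1 + q) r`.

A first estimator must be exact on the span, since its error may depend on `g` only. Interpolation
at `m` points with density proportional to `|det (bᵢ(xⱼ))|²` has this property and gives `q = m`
(`exists_interpolationSampler`). After that, each new sample, drawn from the density `∑ |bₗ|² / m`,
drives one gradient step of size `γ`, which replaces `q` by `(1 - 2γ + γ² m) q + γ² m`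
(`PointSampler.HasError.exists_succ`). About `2m (ln m + 1)` steps of constant size reach `q = 1`;
`j` further steps of decreasing size reach `q = 2m / (2m + j)`.

Part (1) uses `q = 1`, as `√2 ≤ 4`. Part (2) uses `q = 1 / (12 ln (1/δ))`, for which `√(1 + q)` is
the first factor of `A_δ`. The logarithm in the number of points is absorbed by the constants and
the power `ω`. -/

/-! ### Determinants of orthogonal systems -/

theorem measurable_det_of_entries {𝕜 : Type*} [RCLike 𝕜] {Y ι : Type*} [MeasurableSpace Y]
    [Fintype ι] [DecidableEq ι] {M : Y → Matrix ι ι 𝕜} (hM : ∀ i j, Measurable fun y => M y i j) :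
    Measurable fun y => (M y).det := by
  simp only [Matrix.det_apply']
  exact Finset.measurable_sum _ fun σ _ =>
    (Finset.measurable_prod _ fun i _ => hM _ _).const_mul _

/-- For orthogonal functions `h₁, …, hₘ`, the integral of `|det (hᵢ(xⱼ))|²` is `m! ∏ ‖hᵢ‖²`. -/
theorem integral_norm_det_sq {𝕜 : Type*} [RCLike 𝕜] {X ι : Type*} [MeasurableSpace X]
    (μ : Measure X) [SigmaFinite μ] [Fintype ι] [DecidableEq ι] (h : ι → X → 𝕜)
    (hh : ∀ i, MemLp (h i) 2 μ)
    (horth : ∀ i j, i ≠ j → ∫ x, starRingEnd 𝕜 (h i x) * h j x ∂μ = 0) :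
    Integrable (fun x : ι → X => ‖(Matrix.of fun i j => h i (x j)).det‖ ^ 2)
        (Measure.pi fun _ => μ) ∧
      ∫ x, ‖(Matrix.of fun i j => h i (x j)).det‖ ^ 2 ∂(Measure.pi fun _ : ι => μ) =
        (Fintype.card ι).factorial * ∏ i, ∫ x, ‖h i x‖ ^ 2 ∂μ := by
  have hint : ∀ i j, Integrable (fun x => starRingEnd 𝕜 (h i x) * h j x) μ := fun i j =>
    (hh i).star.integrable_mul (hh j)
  -- In the double sum over permutations each variable `xⱼ` enters exactly one factor, so Fubini
  -- applies termwise.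
  have key : ∀ x : ι → X, ((‖(Matrix.of fun i j => h i (x j)).det‖ ^ 2 : ℝ) : 𝕜) =
      ∑ σ : Equiv.Perm ι, ∑ τ : Equiv.Perm ι,
        ((Equiv.Perm.sign σ : ℤ) : 𝕜) * ((Equiv.Perm.sign τ : ℤ) : 𝕜) *
          ∏ j, (starRingEnd 𝕜 (h (σ j) (x j)) * h (τ j) (x j)) := by
    intro x
    rw [RCLike.ofReal_pow, ← RCLike.conj_mul, Matrix.det_apply', map_sum, Finset.sum_mul_sum]
    refine Finset.sum_congr rfl fun σ _ => Finset.sum_congr rfl fun τ _ => ?_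
    rw [map_mul, map_intCast, map_prod, Finset.prod_mul_distrib]
    simp only [Matrix.of_apply]
    ring
  have hI : ∀ σ τ : Equiv.Perm ι, Integrable (fun x : ι → X =>
      ((Equiv.Perm.sign σ : ℤ) : 𝕜) * ((Equiv.Perm.sign τ : ℤ) : 𝕜) *
          ∏ j, (starRingEnd 𝕜 (h (σ j) (x j)) * h (τ j) (x j))) (Measure.pi fun _ => μ) :=
    fun σ τ => (Integrable.fintype_prod (f := fun j y => starRingEnd 𝕜 (h (σ j) y) * h (τ j) y)
      fun j => hint _ _).const_mul _
  have hIsum : Integrable (fun x : ι → X =>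
      ((‖(Matrix.of fun i j => h i (x j)).det‖ ^ 2 : ℝ) : 𝕜)) (Measure.pi fun _ => μ) := by
    simp only [key]
    exact integrable_finsetSum _ fun σ _ => integrable_finsetSum _ fun τ _ => hI σ τ
  refine ⟨by simpa only [RCLike.ofReal_re] using hIsum.re, ?_⟩
  apply RCLike.ofReal_injective (K := 𝕜)
  rw [← integral_ofReal]
  simp only [key]
  rw [integral_finsetSum _ fun σ _ => integrable_finsetSum _ fun τ _ => hI σ τ]
  -- Each term integrates to a product of inner products of `h (σ j)` with `h (τ j)`. One of them
  -- vanishes unless `σ = τ`, where the signs cancel; the `m!` diagonal terms are all equal.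
  have hterm : ∀ σ τ : Equiv.Perm ι, ∫ x : ι → X,
      ((Equiv.Perm.sign σ : ℤ) : 𝕜) * ((Equiv.Perm.sign τ : ℤ) : 𝕜) *
          ∏ j, (starRingEnd 𝕜 (h (σ j) (x j)) * h (τ j) (x j)) ∂(Measure.pi fun _ => μ) =
      if σ = τ then ((∏ i, ∫ x, ‖h i x‖ ^ 2 ∂μ : ℝ) : 𝕜) else 0 := by
    intro σ τ
    rw [integral_const_mul,
      integral_fintype_prod_eq_prod (fun j y => starRingEnd 𝕜 (h (σ j) y) * h (τ j) y)]
    split_ifs with hst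
    · subst hst
      have : ((Equiv.Perm.sign σ : ℤ) : 𝕜) * ((Equiv.Perm.sign σ : ℤ) : 𝕜) = 1 := by
        rw [← Int.cast_mul, ← Units.val_mul, Int.units_mul_self]; simp
      rw [this, one_mul, RCLike.ofReal_prod,
        Equiv.prod_comp σ fun i => ∫ y, starRingEnd 𝕜 (h i y) * h i y ∂μ]
      refine Finset.prod_congr rfl fun i _ => ?_
      rw [← integral_ofReal]
      simp only [RCLike.conj_mul, RCLike.ofReal_pow]
    · obtain ⟨j, hj⟩ : ∃ j, σ j ≠ τ j := by
        by_contra! hcon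
        exact hst (Equiv.ext hcon)
      rw [Finset.prod_eq_zero (Finset.mem_univ j) (horth _ _ hj), mul_zero]
  have : ∀ σ : Equiv.Perm ι, ∫ x : ι → X, ∑ τ : Equiv.Perm ι,
      ((Equiv.Perm.sign σ : ℤ) : 𝕜) * ((Equiv.Perm.sign τ : ℤ) : 𝕜) *
          ∏ j, (starRingEnd 𝕜 (h (σ j) (x j)) * h (τ j) (x j)) ∂(Measure.pi fun _ => μ) =
      ((∏ i, ∫ x, ‖h i x‖ ^ 2 ∂μ : ℝ) : 𝕜) := by
    intro σ
    rw [integral_finsetSum _ fun τ _ => hI σ τ]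
    simp only [hterm, Finset.sum_ite_eq, Finset.mem_univ, if_true]
  simp only [this, Finset.sum_const, Finset.card_univ, Fintype.card_perm, nsmul_eq_mul]
  push_cast
  rfl

/-! ### Random point samplers and their error -/

/-- Orthonormality of measurable functions in `L₂(μ)`. -/
structure IsOrthonormalSystem {𝕜 : Type*} [RCLike 𝕜] {X : Type*} [MeasurableSpace X]
    (μ : Measure X) {m : ℕ} (η : Fin m → X → 𝕜) : Prop where
  measurable : ∀ k, Measurable (η k)
  memLp : ∀ k, MemLp (η k) 2 μ
  integral_eq : ∀ i j, ∫ x, starRingEnd 𝕜 (η i x) * η j x ∂μ = if i = j then 1 else 0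

namespace IsOrthonormalSystem

variable {𝕜 : Type*} [RCLike 𝕜] {X : Type*} [MeasurableSpace X] {μ : Measure X} {m : ℕ}
  {η : Fin m → X → 𝕜}

theorem integral_norm_sq (hη : IsOrthonormalSystem μ η) (i : Fin m) :
    ∫ x, ‖η i x‖ ^ 2 ∂μ = 1 := by
  apply RCLike.ofReal_injective (K := 𝕜)
  rw [← integral_ofReal]
  simpa [RCLike.conj_mul] using hη.integral_eq i i

theorem integrable_norm_sq (hη : IsOrthonormalSystem μ η) (i : Fin m) :
    Integrable (fun x => ‖η i x‖ ^ 2) μ :=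
  (memLp_two_iff_integrable_sq_norm (hη.memLp i).1).1 (hη.memLp i)

end IsOrthonormalSystem

/-- A randomized method that samples a function at `n` random points, each with a law that is
absolutely continuous with respect to `μ`, and computes `m` coefficients from the values. -/
structure PointSampler (𝕜 : Type v) [RCLike 𝕜] {X : Type} [MeasurableSpace X] (μ : Measure X)
    (m n : ℕ) where
  Ω : Type
  [measurableSpace : MeasurableSpace Ω]
  prob : Measure Ω
  [isProbabilityMeasure : IsProbabilityMeasure prob]
  pt : Ω → Fin n → X
  quasi : ∀ i, Measure.QuasiMeasurePreserving (fun ω => pt ω i) prob μ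
  coef : Ω → (Fin n → 𝕜) → Fin m → 𝕜
  measurable_coef : ∀ k, Measurable fun p : Ω × (Fin n → 𝕜) => coef p.1 p.2 k

namespace PointSampler

attribute [instance] measurableSpace isProbabilityMeasure

variable {𝕜 : Type v} [RCLike 𝕜] {X : Type} [MeasurableSpace X] {μ : Measure X} {m n : ℕ}

/-- The coefficients computed from the values of `h`. -/
def apply (S : PointSampler 𝕜 μ m n) (h : X → 𝕜) (ω : S.Ω) : Fin m → 𝕜 :=
  S.coef ω fun i => h (S.pt ω i)

theorem measurable_apply (S : PointSampler 𝕜 μ m n) {h : X → 𝕜} (hh : Measurable h) (k : Fin m) :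
    Measurable fun ω => S.apply h ω k :=
  (S.measurable_coef k).comp
    (measurable_id.prodMk (measurable_pi_lambda _ fun i => hh.comp (S.quasi i).measurable))

/-- For `h = ∑ aₖ ηₖ + g` with `g` orthogonal to all `ηₖ`, the mean square error of the computed
coefficients is at most `q ‖g‖²`. -/
def HasError (S : PointSampler 𝕜 μ m n) (η : Fin m → X → 𝕜) (q : ℝ) : Prop :=
  ∀ (a : Fin m → 𝕜) (g : X → 𝕜), Measurable g → MemLp g 2 μ →
    (∀ k, ∫ x, starRingEnd 𝕜 (η k x) * g x ∂μ = 0) →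
    ∫⁻ ω, ENNReal.ofReal (∑ k, ‖S.apply (fun x => ∑ k, a k * η k x + g x) ω k - a k‖ ^ 2) ∂S.prob ≤
      ENNReal.ofReal (q * ∫ x, ‖g x‖ ^ 2 ∂μ)

theorem HasError.mono {S : PointSampler 𝕜 μ m n} {η : Fin m → X → 𝕜} {q q' : ℝ}
    (h : S.HasError η q) (hq : q ≤ q') : S.HasError η q' := fun a g hg hg2 horth =>
  (h a g hg hg2 horth).trans <| ENNReal.ofReal_le_ofReal <|
    mul_le_mul_of_nonneg_right hq (integral_nonneg fun _ => by positivity)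

end PointSampler

/-! ### Interpolation at determinantal points -/

/-- Interpolation at points drawn from the density `|det (ηᵢ(xⱼ))|² / m!`. -/
theorem exists_interpolationSampler {𝕜 : Type v} [RCLike 𝕜] {X : Type} [MeasurableSpace X]
    {μ : Measure X} [IsProbabilityMeasure μ] {m : ℕ} {η : Fin m → X → 𝕜}
    (hη : IsOrthonormalSystem μ η) : ∃ S : PointSampler 𝕜 μ m m, S.HasError η m := by
  let M : (Fin m → X) → Matrix (Fin m) (Fin m) 𝕜 := fun x => Matrix.of fun i j => η i (x j)
  let w : (Fin m → X) → ℝ := fun x => ‖(M x).det‖ ^ 2 / m.factorial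
  have hM : ∀ i j, Measurable fun x => M x i j := fun i j =>
    (hη.measurable i).comp (measurable_pi_apply j)
  have hw : Measurable w := ((measurable_det_of_entries hM).norm.pow_const 2).div_const _
  have hfac : (0 : ℝ) < m.factorial := by exact_mod_cast m.factorial_pos
  obtain ⟨hI, hIeq⟩ := integral_norm_det_sq μ η hη.memLp fun i j hij => by
    rw [hη.integral_eq, if_neg hij]
  let P : Measure (Fin m → X) :=
    (Measure.pi fun _ => μ).withDensity fun x => ENNReal.ofReal (w x)
  have hP : IsProbabilityMeasure P := by
    constructor
    rw [withDensity_apply _ MeasurableSet.univ, Measure.restrict_univ,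
      ← ofReal_integral_eq_lintegral_ofReal (hI.div_const _)
        (Filter.Eventually.of_forall fun x => by positivity), integral_div, hIeq]
    simp [hη.integral_norm_sq, hfac.ne']
  refine ⟨{
    Ω := Fin m → X
    prob := P
    pt := fun x => x
    quasi := fun i => (measurePreserving_eval (fun _ => μ) i).quasiMeasurePreserving.mono_left
      (withDensity_absolutelyContinuous _ _)
    -- Cramer's rule for the system `∑ cₖ ηₖ(xⱼ) = yⱼ`.
    coef := fun x y i => ((M x).updateRow i y).det / (M x).det
    measurable_coef := fun k => by
      refine Measurable.div (measurable_det_of_entries fun i j => ?_)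
        ((measurable_det_of_entries hM).comp measurable_fst)
      by_cases hi : i = k
      · subst hi
        simp only [Matrix.updateRow_self]
        exact (measurable_pi_apply j).comp measurable_snd
      · simp only [Matrix.updateRow_ne hi]
        exact (hM i j).comp measurable_fst }, ?_⟩
  intro a g hg hg2 horth
  simp only [PointSampler.apply]
  -- The squared numerator of the error in the `i`th coefficient. Replacing `ηᵢ` by `g` leaves the
  -- system orthogonal, so the determinant identity applies again.
  let N : Fin m → (Fin m → X) → ℝ := fun i x =>
    ‖(Matrix.of fun k j => Function.update η i g k (x j)).det‖ ^ 2
  have hN : ∀ i, Integrable (N i) (Measure.pi fun _ => μ) ∧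
      ∫ x, N i x ∂(Measure.pi fun _ => μ) = m.factorial * ∫ x, ‖g x‖ ^ 2 ∂μ := by
    intro i
    have h0 : ∀ k, MemLp (Function.update η i g k) 2 μ := by
      intro k
      by_cases hk : k = i
      · subst hk; simpa using hg2
      · simpa [hk] using hη.memLp k
    have h1 : ∀ k l, k ≠ l → ∫ x, starRingEnd 𝕜 (Function.update η i g k x) *
        Function.update η i g l x ∂μ = 0 := by
      intro k l hkl
      by_cases hk : k = i
      · subst hk
        have := congrArg (starRingEnd 𝕜) (horth l)
        rw [← integral_conj] at this
        simpa [hkl.symm, mul_comm] using this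
      · by_cases hl : l = i
        · subst hl
          simpa [hk] using horth k
        · simp [hk, hl, hη.integral_eq, hkl]
    obtain ⟨hi1, hi2⟩ := integral_norm_det_sq μ _ h0 h1
    refine ⟨hi1, hi2.trans ?_⟩
    rw [Fintype.card_fin, Finset.prod_eq_single i]
    · simp
    · intro k _ hk
      simpa [hk] using hη.integral_norm_sq k
    · simp
  have hrow : ∀ (x : Fin m → X) (i : Fin m),
      ((M x).updateRow i fun j => ∑ k, a k * η k (x j) + g (x j)).det =
        a i * (M x).det + (Matrix.of fun k j => Function.update η i g k (x j)).det := by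
    intro x i
    have h1 : (fun j => ∑ k, a k * η k (x j) + g (x j)) =
        (∑ k, a k • M x k) + fun j => g (x j) := by
      ext j
      simp [M, Finset.sum_apply]
    rw [h1, Matrix.det_updateRow_add, Matrix.det_updateRow_sum, smul_eq_mul]
    congr 2
    ext k j
    by_cases hk : k = i
    · subst hk; simp
    · simp [hk, M]
  -- The density cancels the Cramer denominator. Where the determinant vanishes the density does
  -- too, so only an inequality holds there.
  have hpt : ∀ x : Fin m → X, w x * ∑ i, ‖((M x).updateRow i
      fun j => ∑ k, a k * η k (x j) + g (x j)).det / (M x).det - a i‖ ^ 2 ≤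
      ∑ i, N i x / m.factorial := by
    intro x
    rw [Finset.mul_sum]
    refine Finset.sum_le_sum fun i _ => ?_
    by_cases hd : (M x).det = 0
    · simp only [w, hd, norm_zero]
      have : 0 ≤ N i x / m.factorial := by positivity
      simpa using this
    · rw [hrow, add_div, mul_div_cancel_right₀ _ hd, add_sub_cancel_left, norm_div, div_pow]
      have : ‖(M x).det‖ ≠ 0 := norm_ne_zero_iff.2 hd
      apply le_of_eq
      simp only [w, N]
      field_simp
  have hmeasv : Measurable fun x : Fin m → X => ENNReal.ofReal (∑ i, ‖((M x).updateRow i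
      fun j => ∑ k, a k * η k (x j) + g (x j)).det / (M x).det - a i‖ ^ 2) := by
    refine (Finset.measurable_sum _ fun i _ => ?_).ennreal_ofReal
    refine ((Measurable.sub (Measurable.div ?_ (measurable_det_of_entries hM))
      measurable_const).norm.pow_const 2)
    simp only [hrow]
    refine ((measurable_det_of_entries hM).const_mul _).add
      (measurable_det_of_entries fun k j => ?_)
    simp only [Matrix.of_apply]
    by_cases hk : k = i
    · subst hk; simpa [Function.comp_def] using hg.comp (measurable_pi_apply j)
    · simpa [hk, Function.comp_def] using (hη.measurable k).comp (measurable_pi_apply j)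
  change ∫⁻ x, _ ∂P ≤ _
  rw [lintegral_withDensity_eq_lintegral_mul _ hw.ennreal_ofReal hmeasv]
  calc _ ≤ ∫⁻ x, ENNReal.ofReal (∑ i, N i x / m.factorial) ∂(Measure.pi fun _ => μ) := by
        refine lintegral_mono fun x => ?_
        simp only [Pi.mul_apply]
        rw [← ENNReal.ofReal_mul (by positivity)]
        exact ENNReal.ofReal_le_ofReal (hpt x)
    _ = ENNReal.ofReal (∫ x, ∑ i, N i x / m.factorial ∂(Measure.pi fun _ => μ)) := by
        rw [ofReal_integral_eq_lintegral_ofReal]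
        · exact integrable_finsetSum _ fun i _ => (hN i).1.div_const _
        · exact Filter.Eventually.of_forall fun x => by positivity
    _ ≤ _ := by
        apply le_of_eq
        rw [integral_finsetSum _ fun i _ => (hN i).1.div_const _]
        simp only [integral_div, (hN _).2]
        rw [Finset.sum_const, Finset.card_univ, Fintype.card_fin, nsmul_eq_mul,
          mul_div_cancel_left₀ _ hfac.ne']

/-! ### Stochastic gradient steps -/

/-- One step of stochastic gradient descent, with a sample point `x` drawn from the density
`W/m` for `W = ∑ |ηₖ|²`, contracts the mean square error of the coefficients. -/
theorem lintegral_gradientStep_le {𝕜 : Type v} [RCLike 𝕜] {X : Type} [MeasurableSpace X]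
    {μ : Measure X} {m : ℕ} (hm : 0 < m) {η : Fin m → X → 𝕜}
    (hη : IsOrthonormalSystem μ η) (γ : ℝ) (e : Fin m → 𝕜) {g : X → 𝕜} (hg : Measurable g)
    (hg2 : MemLp g 2 μ) (horth : ∀ k, ∫ x, starRingEnd 𝕜 (η k x) * g x ∂μ = 0) :
    ∫⁻ x, ENNReal.ofReal (∑ k, ‖e k + ((γ * (m / ∑ l, ‖η l x‖ ^ 2) : ℝ) : 𝕜) *
        ((g x - ∑ l, e l * η l x) * starRingEnd 𝕜 (η k x))‖ ^ 2)
        ∂(μ.withDensity fun x => ENNReal.ofReal ((∑ l, ‖η l x‖ ^ 2) / m)) ≤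
      ENNReal.ofReal ((1 - 2 * γ + γ ^ 2 * m) * (∑ k, ‖e k‖ ^ 2) +
        γ ^ 2 * m * ∫ x, ‖g x‖ ^ 2 ∂μ) := by
  have hm' : (0 : ℝ) < m := by exact_mod_cast hm
  set W : X → ℝ := fun x => ∑ l, ‖η l x‖ ^ 2 with hW
  set r : X → 𝕜 := fun x => g x - ∑ l, e l * η l x with hr
  have hWmeas : Measurable W := Finset.measurable_sum _ fun l _ =>
    (hη.measurable l).norm.pow_const 2
  have hrmeas : Measurable r := hg.sub (Finset.measurable_sum _ fun l _ =>
    (hη.measurable l).const_mul _)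
  have hr2 : MemLp r 2 μ := hg2.sub (memLp_finsetSum _ fun l _ => (hη.memLp l).const_mul _)
  have hint : ∀ (u v : X → 𝕜), MemLp u 2 μ → MemLp v 2 μ →
      Integrable (fun x => starRingEnd 𝕜 (u x) * v x) μ := fun u v hu hv =>
    hu.star.integrable_mul hv
  -- The density `W/m` and the weight `m/W` cancel, so the expected update of `e k` is `γ` times
  -- this integral: the step moves towards zero on average.
  have hηr : ∀ k, ∫ x, starRingEnd 𝕜 (η k x) * r x ∂μ = - e k := by
    intro k
    have h1 : ∀ x, starRingEnd 𝕜 (η k x) * r x = starRingEnd 𝕜 (η k x) * g x -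
        ∑ l, e l * (starRingEnd 𝕜 (η k x) * η l x) := by
      intro x
      simp only [hr, mul_sub, Finset.mul_sum]
      congr 1
      exact Finset.sum_congr rfl fun l _ => by ring
    simp only [h1]
    rw [integral_sub (hint _ _ (hη.memLp k) hg2)
      (integrable_finsetSum _ fun l _ => (hint _ _ (hη.memLp k) (hη.memLp l)).const_mul _),
      horth, integral_finsetSum _ fun l _ => (hint _ _ (hη.memLp k) (hη.memLp l)).const_mul _]
    simp only [integral_const_mul, hη.integral_eq]
    simp
  have hgr : ∫ x, starRingEnd 𝕜 (g x) * r x ∂μ = ((∫ x, ‖g x‖ ^ 2 ∂μ : ℝ) : 𝕜) := by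
    have h1 : ∀ x, starRingEnd 𝕜 (g x) * r x = ((‖g x‖ ^ 2 : ℝ) : 𝕜) -
        ∑ l, e l * (starRingEnd 𝕜 (g x) * η l x) := by
      intro x
      rw [RCLike.ofReal_pow, ← RCLike.conj_mul]
      simp only [hr, mul_sub, Finset.mul_sum]
      congr 1
      exact Finset.sum_congr rfl fun l _ => by ring
    have h2 : ∀ l, ∫ x, starRingEnd 𝕜 (g x) * η l x ∂μ = 0 := by
      intro l
      have := congrArg (starRingEnd 𝕜) (horth l)
      rw [← integral_conj] at this
      simpa [mul_comm] using this
    simp only [h1]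
    rw [integral_sub ((memLp_two_iff_integrable_sq_norm hg2.1).1 hg2).ofReal
      (integrable_finsetSum _ fun l _ => (hint _ _ hg2 (hη.memLp l)).const_mul _),
      integral_finsetSum _ fun l _ => (hint _ _ hg2 (hη.memLp l)).const_mul _, integral_ofReal]
    simp only [integral_const_mul, h2]
    simp
  have hrr : ∫ x, ‖r x‖ ^ 2 ∂μ = (∑ k, ‖e k‖ ^ 2) + ∫ x, ‖g x‖ ^ 2 ∂μ := by
    apply RCLike.ofReal_injective (K := 𝕜)
    rw [← integral_ofReal]
    have h1 : ∀ x, ((‖r x‖ ^ 2 : ℝ) : 𝕜) = starRingEnd 𝕜 (g x) * r x -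
        ∑ l, starRingEnd 𝕜 (e l) * (starRingEnd 𝕜 (η l x) * r x) := by
      intro x
      rw [RCLike.ofReal_pow, ← RCLike.conj_mul]
      have hrc : starRingEnd 𝕜 (r x) = starRingEnd 𝕜 (g x) -
          ∑ l, starRingEnd 𝕜 (e l) * starRingEnd 𝕜 (η l x) := by simp [hr]
      rw [hrc, sub_mul, Finset.sum_mul]
      simp only [mul_assoc]
    simp only [h1]
    rw [integral_sub (hint _ _ hg2 hr2)
      (integrable_finsetSum _ fun l _ => (hint _ _ (hη.memLp l) hr2).const_mul _),
      integral_finsetSum _ fun l _ => (hint _ _ (hη.memLp l) hr2).const_mul _, hgr]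
    simp only [integral_const_mul, hηr]
    simp only [mul_neg, RCLike.conj_mul, Finset.sum_neg_distrib, sub_neg_eq_add]
    push_cast
    ring
  -- The expanded square times the density. The quadratic term carries `(m/W)² · W · W/m = m`, which
  -- makes its integral independent of the shape of `W`.
  let B : X → ℝ := fun x => W x / m * ∑ k, ‖e k‖ ^ 2 +
    2 * γ * RCLike.re (∑ k, starRingEnd 𝕜 (e k) * (starRingEnd 𝕜 (η k x) * r x)) +
    γ ^ 2 * m * ‖r x‖ ^ 2
  have hcrossI : Integrable
      (fun x => ∑ k, starRingEnd 𝕜 (e k) * (starRingEnd 𝕜 (η k x) * r x)) μ :=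
    integrable_finsetSum _ fun k _ => (hint _ _ (hη.memLp k) hr2).const_mul _
  have hWI : Integrable W μ := integrable_finsetSum _ fun l _ => hη.integrable_norm_sq l
  have hrI : Integrable (fun x => ‖r x‖ ^ 2) μ := (memLp_two_iff_integrable_sq_norm hr2.1).1 hr2
  have hB1 : Integrable (fun x => W x / m * ∑ k, ‖e k‖ ^ 2) μ := (hWI.div_const _).mul_const _
  have hB2 : Integrable (fun x => 2 * γ *
      RCLike.re (∑ k, starRingEnd 𝕜 (e k) * (starRingEnd 𝕜 (η k x) * r x))) μ :=
    hcrossI.re.const_mul _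
  have hB3 : Integrable (fun x => γ ^ 2 * m * ‖r x‖ ^ 2) μ := hrI.const_mul _
  have hWint : ∫ x, W x ∂μ = m := by
    rw [integral_finsetSum _ fun l _ => hη.integrable_norm_sq l]
    simp [hη.integral_norm_sq]
  have hcross : ∫ x, RCLike.re (∑ k, starRingEnd 𝕜 (e k) * (starRingEnd 𝕜 (η k x) * r x)) ∂μ =
      - ∑ k, ‖e k‖ ^ 2 := by
    have h1 := integral_re hcrossI
    rw [h1, integral_finsetSum _ fun k _ => (hint _ _ (hη.memLp k) hr2).const_mul _]
    simp only [integral_const_mul, hηr, mul_neg, RCLike.conj_mul, Finset.sum_neg_distrib, map_neg,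
      map_sum, ← RCLike.ofReal_pow, RCLike.ofReal_re]
  have hBint : ∫ x, B x ∂μ = (1 - 2 * γ + γ ^ 2 * m) * (∑ k, ‖e k‖ ^ 2) +
        γ ^ 2 * m * ∫ x, ‖g x‖ ^ 2 ∂μ := by
    have h1 : ∫ x, B x ∂μ = ∫ x, W x / m * ∑ k, ‖e k‖ ^ 2 ∂μ + ∫ x, 2 * γ *
        RCLike.re (∑ k, starRingEnd 𝕜 (e k) * (starRingEnd 𝕜 (η k x) * r x)) ∂μ +
        ∫ x, γ ^ 2 * m * ‖r x‖ ^ 2 ∂μ := by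
      have h2 := integral_add (hB1.add hB2) hB3
      have h3 := integral_add hB1 hB2
      simp only [Pi.add_apply] at h2
      rw [← h3, ← h2]
    rw [h1, integral_mul_const, integral_div, hWint, integral_const_mul, hcross,
      integral_const_mul, hrr, div_self hm'.ne']
    ring
  have hpt : ∀ x, W x / m * ∑ k, ‖e k + ((γ * (m / W x) : ℝ) : 𝕜) *
        (r x * starRingEnd 𝕜 (η k x))‖ ^ 2 ≤ B x := by
    intro x
    have hterm : ∀ k, ‖e k + ((γ * (m / W x) : ℝ) : 𝕜) * (r x * starRingEnd 𝕜 (η k x))‖ ^ 2 =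
        ‖e k‖ ^ 2 + 2 * (γ * (m / W x)) *
          RCLike.re (starRingEnd 𝕜 (e k) * (starRingEnd 𝕜 (η k x) * r x)) +
        (γ * (m / W x)) ^ 2 * ‖r x‖ ^ 2 * ‖η k x‖ ^ 2 := by
      intro k
      have h1 := norm_add_sq (𝕜 := 𝕜) (e k)
        (((γ * (m / W x) : ℝ) : 𝕜) * (r x * starRingEnd 𝕜 (η k x)))
      have h2 : inner 𝕜 (e k) (((γ * (m / W x) : ℝ) : 𝕜) * (r x * starRingEnd 𝕜 (η k x))) =
          ((γ * (m / W x) : ℝ) : 𝕜) *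
            (starRingEnd 𝕜 (e k) * (starRingEnd 𝕜 (η k x) * r x)) := by
        rw [RCLike.inner_apply]; ring
      rw [h1, h2, RCLike.re_ofReal_mul, norm_mul, norm_mul, RCLike.norm_conj,
        RCLike.norm_ofReal, mul_pow, mul_pow, sq_abs]
      ring
    simp only [hterm, Finset.sum_add_distrib, ← Finset.mul_sum, ← map_sum]
    change W x / m * (_ + _ + _ * W x) ≤ _
    have hWnn : 0 ≤ W x := Finset.sum_nonneg fun l _ => by positivity
    rcases hWnn.eq_or_lt with h0 | hpos
    -- At a zero of `W` all `η k` vanish and the left side is zero; `B` keeps its nonnegative last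
    -- term.
    · have hz : ∀ k, η k x = 0 := by
        intro k
        have := (Finset.sum_eq_zero_iff_of_nonneg
          (fun l _ => by positivity : ∀ l ∈ Finset.univ, 0 ≤ ‖η l x‖ ^ 2)).1 h0.symm k
          (Finset.mem_univ k)
        simpa using this
      have : 0 ≤ γ ^ 2 * m * ‖r x‖ ^ 2 := by positivity
      simpa [B, ← h0, hz] using this
    · apply le_of_eq
      simp only [B]
      generalize RCLike.re (∑ k, starRingEnd 𝕜 (e k) * (starRingEnd 𝕜 (η k x) * r x)) = t
      field_simp
  have hmeas : Measurable fun x => ENNReal.ofReal (∑ k, ‖e k + ((γ * (m / W x) : ℝ) : 𝕜) *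
        (r x * starRingEnd 𝕜 (η k x))‖ ^ 2) := by
    refine (Finset.measurable_sum _ fun k _ => ?_).ennreal_ofReal
    refine (measurable_const.add (Measurable.mul ?_ (hrmeas.mul ?_))).norm.pow_const 2
    · exact RCLike.measurable_ofReal.comp ((hWmeas.const_div _).const_mul _)
    · exact RCLike.continuous_conj.measurable.comp (hη.measurable k)
  change ∫⁻ x, ENNReal.ofReal (∑ k, ‖e k + ((γ * (m / W x) : ℝ) : 𝕜) *
        (r x * starRingEnd 𝕜 (η k x))‖ ^ 2)
        ∂(μ.withDensity fun x => ENNReal.ofReal (W x / m)) ≤ _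
  rw [lintegral_withDensity_eq_lintegral_mul _ (hWmeas.div_const _).ennreal_ofReal hmeas]
  have hle : ∀ x, 0 ≤ W x / m * ∑ k, ‖e k + ((γ * (m / W x) : ℝ) : 𝕜) *
        (r x * starRingEnd 𝕜 (η k x))‖ ^ 2 := fun x => by positivity
  calc _ ≤ ∫⁻ x, ENNReal.ofReal (B x) ∂μ := by
        refine lintegral_mono fun x => ?_
        simp only [Pi.mul_apply]
        rw [← ENNReal.ofReal_mul (by positivity)]
        exact ENNReal.ofReal_le_ofReal (hpt x)
    _ = ENNReal.ofReal (∫ x, B x ∂μ) := by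
        have hBI : Integrable B μ := (hB1.add hB2).add hB3
        rw [ofReal_integral_eq_lintegral_ofReal hBI
          (Filter.Eventually.of_forall fun x => (hle x).trans (hpt x))]
    _ ≤ _ := by rw [hBint]

/-- Adding one gradient step to a sampler. -/
theorem PointSampler.HasError.exists_succ {𝕜 : Type v} [RCLike 𝕜] {X : Type} [MeasurableSpace X]
    {μ : Measure X} [SFinite μ] {m n : ℕ} (hm : 0 < m) {η : Fin m → X → 𝕜}
    (hη : IsOrthonormalSystem μ η) {S : PointSampler 𝕜 μ m n} {q : ℝ} (hq : 0 ≤ q)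
    (hS : S.HasError η q) (γ : ℝ) :
    ∃ S' : PointSampler 𝕜 μ m (n + 1),
      S'.HasError η ((1 - 2 * γ + γ ^ 2 * m) * q + γ ^ 2 * m) := by
  have hm' : (0 : ℝ) < m := by exact_mod_cast hm
  let W : X → ℝ := fun x => ∑ l, ‖η l x‖ ^ 2
  have hWmeas : Measurable W := Finset.measurable_sum _ fun l _ =>
    (hη.measurable l).norm.pow_const 2
  let ν : Measure X := μ.withDensity fun x => ENNReal.ofReal (W x / m)
  have hν : IsProbabilityMeasure ν := by
    constructor
    rw [withDensity_apply _ MeasurableSet.univ, Measure.restrict_univ,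
      ← ofReal_integral_eq_lintegral_ofReal
        ((integrable_finsetSum _ fun l _ => hη.integrable_norm_sq l).div_const _)
        (Filter.Eventually.of_forall fun x => by positivity), integral_div,
      integral_finsetSum _ fun l _ => hη.integrable_norm_sq l]
    simp [hη.integral_norm_sq, hm'.ne']
  refine ⟨{
    Ω := S.Ω × X
    prob := S.prob.prod ν
    pt := fun ω => Fin.snoc (S.pt ω.1) ω.2
    quasi := fun i => by
      refine Fin.lastCases ?_ (fun j => ?_) i
      · simp only [Fin.snoc_last]
        exact ⟨measurable_snd, Measure.quasiMeasurePreserving_snd.absolutelyContinuous.trans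
          (withDensity_absolutelyContinuous _ _)⟩
      · simp only [Fin.snoc_castSucc]
        exact (S.quasi j).comp Measure.quasiMeasurePreserving_fst
    coef := fun ω y k => S.coef ω.1 (fun i => y i.castSucc) k +
      ((γ * (m / W ω.2) : ℝ) : 𝕜) * ((y (Fin.last n) -
        ∑ l, S.coef ω.1 (fun i => y i.castSucc) l * η l ω.2) * starRingEnd 𝕜 (η k ω.2))
    measurable_coef := fun k => by
      have hc : ∀ l, Measurable fun p : (S.Ω × X) × (Fin (n + 1) → 𝕜) =>
          S.coef p.1.1 (fun i => p.2 i.castSucc) l := fun l =>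
        (S.measurable_coef l).comp ((measurable_fst.comp measurable_fst).prodMk
          (measurable_pi_lambda _ fun i => (measurable_pi_apply _).comp measurable_snd))
      have hx : Measurable fun p : (S.Ω × X) × (Fin (n + 1) → 𝕜) => p.1.2 :=
        measurable_snd.comp measurable_fst
      refine (hc k).add (Measurable.mul ?_ (Measurable.mul (Measurable.sub ?_ ?_) ?_))
      · exact RCLike.measurable_ofReal.comp (((hWmeas.comp hx).const_div _).const_mul _)
      · exact (measurable_pi_apply _).comp measurable_snd
      · exact Finset.measurable_sum _ fun l _ => (hc l).mul ((hη.measurable l).comp hx)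
      · exact RCLike.continuous_conj.measurable.comp ((hη.measurable k).comp hx) }, ?_⟩
  intro a g hg hg2 horth
  set h : X → 𝕜 := fun x => ∑ k, a k * η k x + g x with hh
  have hhm : Measurable h := (Finset.measurable_sum _ fun k _ =>
    (hη.measurable k).const_mul _).add hg
  -- Since `m ≥ 1`, this is at least `(1 - γ)²`.
  have hq' : 0 ≤ 1 - 2 * γ + γ ^ 2 * m := by
    have : (1 : ℝ) ≤ m := by exact_mod_cast hm
    nlinarith [sq_nonneg (1 - γ), sq_nonneg γ]
  have hG : 0 ≤ ∫ x, ‖g x‖ ^ 2 ∂μ := integral_nonneg fun _ => by positivity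
  -- The observed residual of `h` equals the residual of `g` against the coefficient errors, so the
  -- update acts on the errors alone.
  have hinner : ∀ ω (x : X), (∑ k, ‖S.apply h ω k + ((γ * (m / W x) : ℝ) : 𝕜) * ((h x -
        ∑ l, S.apply h ω l * η l x) * starRingEnd 𝕜 (η k x)) - a k‖ ^ 2) =
      ∑ k, ‖(S.apply h ω k - a k) + ((γ * (m / ∑ l, ‖η l x‖ ^ 2) : ℝ) : 𝕜) *
        ((g x - ∑ l, (S.apply h ω l - a l) * η l x) * starRingEnd 𝕜 (η k x))‖ ^ 2 := by
    intro ω x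
    refine Finset.sum_congr rfl fun k _ => ?_
    have : h x - ∑ l, S.apply h ω l * η l x = g x - ∑ l, (S.apply h ω l - a l) * η l x := by
      simp only [hh, sub_mul, Finset.sum_sub_distrib]
      ring
    rw [this, add_sub_right_comm]
  simp only [PointSampler.apply, Fin.snoc_castSucc, Fin.snoc_last]
  change ∫⁻ p : S.Ω × X, ENNReal.ofReal (∑ k, ‖S.apply h p.1 k + ((γ * (m / W p.2) : ℝ) : 𝕜) *
    ((h p.2 - ∑ l, S.apply h p.1 l * η l p.2) * starRingEnd 𝕜 (η k p.2)) - a k‖ ^ 2)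
      ∂(S.prob.prod ν) ≤ _
  rw [lintegral_prod]
  · simp only [hinner]
    calc _ ≤ ∫⁻ ω, ENNReal.ofReal ((1 - 2 * γ + γ ^ 2 * m) * (∑ k, ‖S.apply h ω k - a k‖ ^ 2) +
        γ ^ 2 * m * ∫ x, ‖g x‖ ^ 2 ∂μ) ∂S.prob :=
          lintegral_mono fun ω => lintegral_gradientStep_le hm hη γ _ hg hg2 horth
      _ = ∫⁻ ω, (ENNReal.ofReal (1 - 2 * γ + γ ^ 2 * m) *
            ENNReal.ofReal (∑ k, ‖S.apply h ω k - a k‖ ^ 2) +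
            ENNReal.ofReal (γ ^ 2 * m * ∫ x, ‖g x‖ ^ 2 ∂μ)) ∂S.prob := by
          refine lintegral_congr fun ω => ?_
          rw [ENNReal.ofReal_add (by positivity) (by positivity), ENNReal.ofReal_mul hq']
      _ = ENNReal.ofReal (1 - 2 * γ + γ ^ 2 * m) *
            (∫⁻ ω, ENNReal.ofReal (∑ k, ‖S.apply h ω k - a k‖ ^ 2) ∂S.prob) +
            ENNReal.ofReal (γ ^ 2 * m * ∫ x, ‖g x‖ ^ 2 ∂μ) := by
          rw [lintegral_add_right _ measurable_const, lintegral_const_mul' _ _ ENNReal.ofReal_ne_top]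
          simp
      _ ≤ ENNReal.ofReal (1 - 2 * γ + γ ^ 2 * m) * ENNReal.ofReal (q * ∫ x, ‖g x‖ ^ 2 ∂μ) +
            ENNReal.ofReal (γ ^ 2 * m * ∫ x, ‖g x‖ ^ 2 ∂μ) := by
          gcongr
          exact hS a g hg hg2 horth
      _ = _ := by
          rw [← ENNReal.ofReal_mul hq', ← ENNReal.ofReal_add (by positivity) (by positivity)]
          congr 1
          ring
  · have hc : ∀ l, Measurable fun p : S.Ω × X => S.apply h p.1 l := fun l =>
      (S.measurable_apply hhm l).comp measurable_fst
    refine (Finset.measurable_sum _ fun k _ => ?_).ennreal_ofReal.aemeasurable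
    refine (((hc k).add (Measurable.mul ?_ (Measurable.mul (Measurable.sub ?_ ?_) ?_))).sub
      measurable_const).norm.pow_const 2
    · exact RCLike.measurable_ofReal.comp (((hWmeas.comp measurable_snd).const_div _).const_mul _)
    · exact hhm.comp measurable_snd
    · exact Finset.measurable_sum _ fun l _ => (hc l).mul ((hη.measurable l).comp measurable_snd)
    · exact RCLike.continuous_conj.measurable.comp ((hη.measurable k).comp measurable_snd)

/-! ### Choice of the step sizes -/

/-- After `m` interpolation points and `k` gradient steps of constant size. -/
theorem exists_sampler_constantStep {𝕜 : Type v} [RCLike 𝕜] {X : Type} [MeasurableSpace X]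
    {μ : Measure X} [IsProbabilityMeasure μ] {m : ℕ} (hm : 0 < m) {η : Fin m → X → 𝕜}
    (hη : IsOrthonormalSystem μ η) (k : ℕ) :
    ∃ S : PointSampler 𝕜 μ m (m + k), S.HasError η ((1 - 3 / (4 * m)) ^ k * m + 1 / 3) := by
  have hm' : (1 : ℝ) ≤ m := by exact_mod_cast hm
  have h0 : (0 : ℝ) ≤ 1 - 3 / (4 * m) := by
    rw [sub_nonneg, div_le_one (by positivity)]; linarith
  induction k with
  | zero =>
    obtain ⟨S, hS⟩ := exists_interpolationSampler hη
    exact ⟨S, hS.mono (by norm_num)⟩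
  | succ k ih =>
    obtain ⟨S, hS⟩ := ih
    -- This `γ` gives contraction factor `1 - 3/(4m)` and noise `1/(4m)`; the fixed point of the
    -- recursion is `1/3`.
    obtain ⟨S', hS'⟩ := hS.exists_succ hm hη (by positivity) (1 / (2 * m))
    refine ⟨S', hS'.mono (le_of_eq ?_)⟩
    rw [pow_succ _ k]
    generalize (1 - 3 / (4 * m) : ℝ) ^ k = p
    field_simp
    ring

/-- `m + ⌈2 m (ln m + 1)⌉ + j` points suffice for the error `2m / (2m + j)`. -/
theorem exists_sampler_decreasingStep {𝕜 : Type v} [RCLike 𝕜] {X : Type} [MeasurableSpace X]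
    {μ : Measure X} [IsProbabilityMeasure μ] {m : ℕ} (hm : 0 < m) {η : Fin m → X → 𝕜}
    (hη : IsOrthonormalSystem μ η) (j : ℕ) :
    ∃ S : PointSampler 𝕜 μ m (m + ⌈2 * m * (Real.log m + 1)⌉₊ + j),
      S.HasError η (2 * m / (2 * m + j)) := by
  have hm' : (1 : ℝ) ≤ m := by exact_mod_cast hm
  induction j with
  | zero =>
    obtain ⟨S, hS⟩ := exists_sampler_constantStep hm hη ⌈2 * m * (Real.log m + 1)⌉₊
    refine ⟨S, hS.mono ?_⟩
    have hk := Nat.le_ceil (2 * m * (Real.log m + 1))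
    set k := ⌈2 * m * (Real.log m + 1)⌉₊
    have h0 : (0 : ℝ) ≤ 1 - 3 / (4 * m) := by
      rw [sub_nonneg, div_le_one (by positivity)]; linarith
    -- The number of steps makes the first summand at most `exp (-1) ≤ 1/2`, and `1/2 + 1/3 ≤ 1`.
    have h1 : (1 - 3 / (4 * m) : ℝ) ^ k ≤ Real.exp (-(3 / (4 * m))) ^ k :=
      pow_le_pow_left₀ h0 (Real.one_sub_le_exp_neg _) _
    have h2 : Real.exp (-(3 / (4 * m))) ^ k ≤ Real.exp (-(Real.log m + 1)) := by
      rw [← Real.exp_nat_mul, Real.exp_le_exp]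
      have hl : 0 ≤ Real.log m := Real.log_nonneg hm'
      have : (3 / 2 : ℝ) * (Real.log m + 1) ≤ k * (3 / (4 * m)) := by
        calc (3 / 2 : ℝ) * (Real.log m + 1) = 2 * m * (Real.log m + 1) * (3 / (4 * m)) := by
              field_simp; norm_num
          _ ≤ _ := by gcongr
      linarith
    have h3 : Real.exp (-(Real.log m + 1)) * m = Real.exp (-1) := by
      rw [neg_add, Real.exp_add, Real.exp_neg, Real.exp_log (by linarith)]
      field_simp
    have h4 : Real.exp (-1) ≤ 1 / 2 := by
      rw [Real.exp_neg, ← one_div]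
      exact one_div_le_one_div_of_le (by norm_num) (by linarith [Real.add_one_le_exp (1 : ℝ)])
    have h5 : (1 - 3 / (4 * m) : ℝ) ^ k * m ≤ Real.exp (-(Real.log m + 1)) * m := by
      gcongr; exact h1.trans h2
    have h6 : (2 * m / (2 * m + (0 : ℕ)) : ℝ) = 1 := by
      rw [Nat.cast_zero, add_zero, div_self (by positivity)]
    rw [h6]
    linarith
  | succ j ih =>
    obtain ⟨S, hS⟩ := ih
    obtain ⟨S', hS'⟩ := hS.exists_succ hm hη (by positivity) (1 / (2 * m + j))
    refine ⟨S', hS'.mono ?_⟩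
    have hj : (0 : ℝ) ≤ j := by positivity
    push_cast
    rw [le_div_iff₀ (by positivity)]
    have hs : (0 : ℝ) < 2 * m + j := by positivity
    have : ((1 - 2 * (1 / (2 * m + j)) + (1 / (2 * m + j)) ^ 2 * m) * (2 * m / (2 * m + j)) +
        (1 / (2 * m + j)) ^ 2 * m : ℝ) =
        m * (2 * (2 * m + j) ^ 2 - 3 * (2 * m + j) + 2 * m) / (2 * m + j) ^ 3 := by
      field_simp
      ring
    rw [this, div_mul_eq_mul_div, div_le_iff₀ (by positivity)]
    have hs1 : (2 * m : ℝ) ≤ 2 * m + j := by linarith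
    rw [← add_assoc]
    generalize (2 * m + j : ℝ) = s at *
    -- With `s = 2m + j`, this is `2m s³ - m (2s² - 3s + 2m)(s + 1)`, the slack of the claim after
    -- clearing denominators.
    have : 0 ≤ m * (s * (s - 2 * m) + (s - 2 * m) + 2 * s : ℝ) := by
      have : 0 ≤ s - 2 * m := by linarith
      positivity
    nlinarith

/-! ### Linear information and approximating subspaces -/

/-- If `‖T f‖ ≤ r` on the part of the unit ball where `n` linear functionals vanish, then the image
of the unit ball lies within distance `r` of a subspace of dimension at most `n`. -/
theorem exists_submodule_norm_sub_le {𝕜 F G : Type*} [RCLike 𝕜] [NormedAddCommGroup F]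
    [InnerProductSpace 𝕜 F] [CompleteSpace F] [NormedAddCommGroup G] [NormedSpace 𝕜 G]
    (T : F →ₗ[𝕜] G) (hT : Continuous T) {n : ℕ} (L : Fin n → F →ₗ[𝕜] 𝕜) {r : ℝ} (hr : 0 ≤ r)
    (h : ∀ f, ‖f‖ ≤ 1 → (∀ i, L i f = 0) → ‖T f‖ ≤ r) :
    ∃ V : Submodule 𝕜 G, FiniteDimensional 𝕜 V ∧ Module.finrank 𝕜 V ≤ n ∧
      ∀ f, ‖f‖ ≤ 1 → ∃ v ∈ V, ‖T f - v‖ ≤ r := by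
  let Φ : F →ₗ[𝕜] (Fin n → 𝕜) := LinearMap.pi L
  -- The functionals may be discontinuous, so their common kernel need not be closed. Continuity of
  -- `T` carries the bound to the closure, and enlarging the kernel only shrinks the orthogonal
  -- complement.
  let K : Submodule 𝕜 F := (LinearMap.ker Φ).topologicalClosure
  have hKle : LinearMap.ker Φ ≤ K := Submodule.le_topologicalClosure _
  have : CompleteSpace K := (Submodule.isClosed_topologicalClosure _).completeSpace_coe
  have hker : ∀ f ∈ LinearMap.ker Φ, ‖T f‖ ≤ r * ‖f‖ := by
    intro f hf
    by_cases h0 : f = 0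
    · simp [h0]
    have hn : ‖f‖ ≠ 0 := norm_ne_zero_iff.2 h0
    have h1 := h (((‖f‖⁻¹ : ℝ) : 𝕜) • f) (by
      rw [norm_smul, RCLike.norm_ofReal, abs_of_nonneg (by positivity), inv_mul_cancel₀ hn])
      (fun i => by
        have : L i f = 0 := congrFun (LinearMap.mem_ker.1 hf) i
        rw [map_smul, this, smul_zero])
    rw [map_smul, norm_smul, RCLike.norm_ofReal, abs_of_nonneg (by positivity)] at h1
    have hp : 0 < ‖f‖ := norm_pos_iff.2 h0
    rwa [inv_mul_le_iff₀ hp, mul_comm] at h1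
  have hK : ∀ f ∈ K, ‖T f‖ ≤ r * ‖f‖ := by
    have hcl : IsClosed {f : F | ‖T f‖ ≤ r * ‖f‖} :=
      isClosed_le hT.norm (continuous_const.mul continuous_norm)
    exact fun f hf => closure_minimal (fun g hg => hker g hg) hcl hf
  let Ψ : Kᗮ →ₗ[𝕜] (Fin n → 𝕜) := Φ ∘ₗ Kᗮ.subtype
  have hΨ : Function.Injective Ψ := by
    rw [← LinearMap.ker_eq_bot, LinearMap.ker_eq_bot']
    intro f hf
    have h1 : (f : F) ∈ K := hKle (LinearMap.mem_ker.2 hf)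
    have h2 : (f : F) ∈ K ⊓ Kᗮ := ⟨h1, f.2⟩
    rw [Submodule.inf_orthogonal_eq_bot, Submodule.mem_bot] at h2
    exact Subtype.ext h2
  have hfin : FiniteDimensional 𝕜 Kᗮ := Module.Finite.of_injective Ψ hΨ
  refine ⟨Kᗮ.map T, inferInstance, ?_, ?_⟩
  · refine (Submodule.finrank_map_le T Kᗮ).trans ?_
    simpa using LinearMap.finrank_le_finrank_of_injective hΨ
  · intro f hf
    obtain ⟨p, hp, q, hq, rfl⟩ := K.exists_add_mem_mem_orthogonal f
    refine ⟨T q, Submodule.mem_map_of_mem hq, ?_⟩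
    rw [map_add, add_sub_cancel_right]
    have hpq : ‖p + q‖ * ‖p + q‖ = ‖p‖ * ‖p‖ + ‖q‖ * ‖q‖ :=
      norm_add_sq_eq_norm_sq_add_norm_sq_of_inner_eq_zero p q
        (Submodule.inner_right_of_mem_orthogonal hp hq)
    have hp1 : ‖p‖ ≤ 1 := by nlinarith [norm_nonneg p, norm_nonneg q, norm_nonneg (p + q)]
    calc ‖T p‖ ≤ r * ‖p‖ := hK p hp
      _ ≤ r * 1 := by gcongr
      _ = r := mul_one r

/-- The squared distance to a combination of orthonormal vectors. -/
theorem Orthonormal.norm_sub_sum_sq {𝕜 G : Type*} [RCLike 𝕜] [NormedAddCommGroup G]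
    [InnerProductSpace 𝕜 G] {ι : Type*} [Fintype ι] {b : ι → G} (hb : Orthonormal 𝕜 b) (x : G)
    (c : ι → 𝕜) :
    ‖x - ∑ k, c k • b k‖ ^ 2 =
      ‖x - ∑ k, inner 𝕜 (b k) x • b k‖ ^ 2 + ∑ k, ‖c k - inner 𝕜 (b k) x‖ ^ 2 := by
  classical
  set z := x - ∑ k, inner 𝕜 (b k) x • b k with hz
  have hzb : ∀ k, inner 𝕜 z (b k) = 0 := by
    intro k
    rw [hz, inner_sub_left, sum_inner]
    simp [inner_smul_left, orthonormal_iff_ite.1 hb, inner_conj_symm]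
  have h1 : x - ∑ k, c k • b k = z - ∑ k, (c k - inner 𝕜 (b k) x) • b k := by
    simp only [hz, sub_smul, Finset.sum_sub_distrib]
    abel
  have h2 : inner 𝕜 z (∑ k, (c k - inner 𝕜 (b k) x) • b k) = 0 := by
    simp [inner_sum, inner_smul_right, hzb]
  have h3 : ‖∑ k, (c k - inner 𝕜 (b k) x) • b k‖ ^ 2 = ∑ k, ‖c k - inner 𝕜 (b k) x‖ ^ 2 := by
    apply RCLike.ofReal_injective (K := 𝕜)
    rw [RCLike.ofReal_pow, ← inner_self_eq_norm_sq_to_K, hb.inner_sum, RCLike.ofReal_sum]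
    exact Finset.sum_congr rfl fun k _ => by rw [RCLike.conj_mul, RCLike.ofReal_pow]
  rw [h1, norm_sub_sq (𝕜 := 𝕜), h2, h3]
  simp

/-! ### Transfer to the approximation problem -/

namespace ApproxProblem

variable {𝕜 : Type v} [RCLike 𝕜] {d : ℕ}

instance (P : ApproxProblem.{u} 𝕜 d) : IsProbabilityMeasure P.μ := by
  constructor
  rw [μ, densityOn, withDensity_apply _ MeasurableSet.univ, Measure.restrict_univ]
  exact P.lintegral_ρ

theorem continuous_app (P : ApproxProblem.{u} 𝕜 d) : Continuous P.app :=
  IsCompactOperator.continuous (f := P.app) P.isCompact_embedding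

theorem nonempty_D (P : ApproxProblem.{u} 𝕜 d) : Nonempty P.D :=
  (nonempty_of_measure_ne_zero P.volume_D_pos.ne').to_subtype

theorem app_ae_eq (P : ApproxProblem.{u} 𝕜 d) (f : P.F) : P.app f =ᵐ[P.μ] P.eval f :=
  MemLp.coeFn_toLp (P.memLp_eval f)

/-- Evaluation at `x` as a linear functional. -/
def evalAt (P : ApproxProblem.{u} 𝕜 d) (x : P.D) : P.F →ₗ[𝕜] 𝕜 :=
  LinearMap.proj x ∘ₗ P.eval

theorem isOrthonormalSystem (P : ApproxProblem.{u} 𝕜 d) {m : ℕ} {b : Fin m → P.G}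
    (hb : Orthonormal 𝕜 b) : IsOrthonormalSystem P.μ fun k => (b k : P.D → 𝕜) where
  measurable k := (Lp.stronglyMeasurable (b k)).measurable
  memLp k := Lp.memLp (b k)
  integral_eq i j := by
    have := orthonormal_iff_ite.1 hb i j
    rw [L2.inner_def] at this
    rw [← this]
    refine integral_congr_ae (Filter.Eventually.of_forall fun x => ?_)
    simp only [RCLike.inner_apply]
    ring

/-- Elements of `G` are classes of functions while samples are point values. Absolute continuity of
the law of each point makes the choice of representative irrelevant. -/
theorem apply_congr (P : ApproxProblem.{u} 𝕜 d) {m N : ℕ} (S : PointSampler 𝕜 P.μ m N)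
    {h h' : P.D → 𝕜} (hh : h =ᵐ[P.μ] h') : ∀ᵐ ω ∂S.prob, S.apply h ω = S.apply h' ω := by
  have : ∀ᵐ ω ∂S.prob, ∀ i, h (S.pt ω i) = h' (S.pt ω i) :=
    ae_all_iff.2 fun i => (S.quasi i).ae hh
  filter_upwards [this] with ω hω
  simp only [PointSampler.apply, hω]

/-- The randomized algorithm with output `∑ cₖ bₖ`, for the coefficients `cₖ` computed by a
sampler. -/
theorem exists_randAlg (P : ApproxProblem.{u} 𝕜 d) {m N : ℕ} (S : PointSampler 𝕜 P.μ m N)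
    (b : Fin m → P.G) : ∃ A : RandAlg P P.stdInfo, A.card ≤ N ∧
      A.error = ⨆ (f : P.F) (_ : ‖f‖ ≤ 1),
        (∫⁻ ω, ‖P.app f - ∑ k, S.apply (P.eval f) ω k • b k‖ₑ ^ 2 ∂S.prob) ^ (1 / 2 : ℝ) := by
  classical
  obtain ⟨x₀⟩ := P.nonempty_D
  -- Halting occurs exactly at `N`, so the default point `x₀` is never sampled, and the default
  -- value `0` in `φ` never reaches the output.
  let L : S.Ω → ℕ → (P.F →ₗ[𝕜] 𝕜) := fun ω j =>
    P.evalAt (if h : j < N then S.pt ω ⟨j, h⟩ else x₀)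
  let halt : S.Ω → (k : ℕ) → Set (Fin k → 𝕜) := fun _ k => {_y | k = N}
  let φ : S.Ω → (k : ℕ) → (Fin k → 𝕜) → P.G := fun ω k y =>
    ∑ l, S.coef ω (fun i : Fin N => if h : (i : ℕ) < k then y ⟨i, h⟩ else 0) l • b l
  have hterm : ∀ ω f, ∃ k, (fun i : Fin k => L ω i f) ∈ halt ω k := fun ω f => ⟨N, rfl⟩
  have hfind : ∀ ω f, @Nat.find _ (fun _ => Classical.propDecidable _) (hterm ω f) = N :=
    fun ω f => by
      rw [@Nat.find_eq_iff]
      exact ⟨rfl, fun k hk => hk.ne⟩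
  have hφ : ∀ ω f k, k = N → φ ω k (fun i => L ω i f) = ∑ l, S.apply (P.eval f) ω l • b l := by
    rintro ω f k rfl
    refine Finset.sum_congr rfl fun l _ => ?_
    congr 2
    ext i
    simp [L, evalAt]
  have hout : ∀ f, AEStronglyMeasurable
      (fun ω => ∑ l, S.apply (P.eval f) ω l • b l) S.prob := by
    intro f
    obtain ⟨h, hhm, hh⟩ := (P.memLp_eval f).1.aemeasurable
    have hsm : StronglyMeasurable fun ω => ∑ l, S.apply h ω l • b l :=
      Finset.stronglyMeasurable_fun_sum _ fun l _ =>
        (S.measurable_apply hhm l).stronglyMeasurable.smul_const _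
    refine hsm.aestronglyMeasurable.congr ?_
    filter_upwards [P.apply_congr S hh] with ω hω
    simp only [hω]
  have hval : ∀ (k : ℕ) (i : Fin N), Measurable fun y : Fin k → 𝕜 =>
      if h : (i : ℕ) < k then y ⟨i, h⟩ else 0 := by
    intro k i
    split_ifs with h
    · exact measurable_pi_apply _
    · exact measurable_const
  let A : RandAlg P P.stdInfo :=
    { Ω := S.Ω
      prob := S.prob
      L := L
      L_mem := fun ω j => ⟨_, fun f => rfl⟩
      halt := halt
      measurableSet_halt := fun ω k => MeasurableSet.const _
      terminates := hterm
      φ := φ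
      measurable_φ := fun ω k => Finset.stronglyMeasurable_fun_sum _ fun l _ =>
        ((S.measurable_coef l).comp (measurable_const.prodMk
          (measurable_pi_lambda _ fun i => hval k i))).stronglyMeasurable.smul_const _
      aemeasurable_card := fun f => by simp only [hfind]; exact aemeasurable_const
      aestronglyMeasurable_out := fun f => by
        simp only [hφ _ _ _ (hfind _ _)]
        exact hout f }
  have hnum : ∀ f ω, A.numEval f ω = N := fun f ω => hfind ω f
  have hAout : ∀ f ω, A.out f ω = ∑ l, S.apply (P.eval f) ω l • b l := fun f ω =>
    hφ ω f _ (hnum f ω)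
  refine ⟨A, ?_, ?_⟩
  · refine iSup₂_le fun f _ => ?_
    simp only [hnum, lintegral_const, measure_univ, mul_one, le_refl]
  · simp only [RandAlg.error, hAout]
    rfl

/-- By Pythagoras the squared error splits into the projection error `‖z‖²` and the coefficient
error, at most `q ‖z‖²`. Positivity of `N'` is needed because index `0` admits only the zero
algorithm. -/
theorem ranMinError_le_of_hasError (P : ApproxProblem.{u} 𝕜 d) {m N N' : ℕ}
    {S : PointSampler 𝕜 P.μ m N} {b : Fin m → P.G} (hb : Orthonormal 𝕜 b) {q r : ℝ} (hq : 0 ≤ q)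
    (hS : S.HasError (fun k => (b k : P.D → 𝕜)) q) (hr : 0 ≤ r)
    (h : ∀ f : P.F, ‖f‖ ≤ 1 → ‖P.app f - ∑ k, inner 𝕜 (b k) (P.app f) • b k‖ ≤ r)
    (hN' : 0 < N') (hN : N ≤ N') :
    P.ranMinError P.stdInfo N' ≤ ENNReal.ofReal (√(1 + q) * r) := by
  obtain ⟨n, rfl⟩ := Nat.exists_eq_add_one_of_ne_zero hN'.ne'
  obtain ⟨A, hcard, herr⟩ := P.exists_randAlg S b
  refine (iInf₂_le A (hcard.trans (by exact_mod_cast hN))).trans ?_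
  rw [herr]
  refine iSup₂_le fun f hf => ?_
  have hη := P.isOrthonormalSystem hb
  let a : Fin m → 𝕜 := fun k => inner 𝕜 (b k) (P.app f)
  let z : P.G := P.app f - ∑ k, a k • b k
  let g : P.D → 𝕜 := z
  have hgm : Measurable g := (Lp.stronglyMeasurable z).measurable
  have hg2 : MemLp g 2 P.μ := Lp.memLp z
  have hginner : ∀ y : P.G, ∫ x, starRingEnd 𝕜 (y x) * g x ∂P.μ = inner 𝕜 y z := by
    intro y
    rw [L2.inner_def]
    refine integral_congr_ae (Filter.Eventually.of_forall fun x => ?_)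
    simp only [RCLike.inner_apply, g]
    ring
  have horth : ∀ k, ∫ x, starRingEnd 𝕜 (b k x) * g x ∂P.μ = 0 := by
    intro k
    rw [hginner]
    simp [z, a, inner_sub_right, inner_sum, inner_smul_right, orthonormal_iff_ite.1 hb]
  have hgsq : ∫ x, ‖g x‖ ^ 2 ∂P.μ = ‖z‖ ^ 2 := by
    apply RCLike.ofReal_injective (K := 𝕜)
    rw [← integral_ofReal, RCLike.ofReal_pow ‖z‖, ← inner_self_eq_norm_sq_to_K, ← hginner]
    refine integral_congr_ae (Filter.Eventually.of_forall fun x => ?_)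
    simp only [g, RCLike.conj_mul, RCLike.ofReal_pow]
  have hdecomp : P.eval f =ᵐ[P.μ] fun x => ∑ k, a k * b k x + g x := by
    have h1 : g =ᵐ[P.μ] P.app f - ⇑(∑ k, a k • b k) := Lp.coeFn_sub _ _
    have h2 : ⇑(∑ k, a k • b k) =ᵐ[P.μ] ∑ k, ⇑(a k • b k) := Lp.coeFn_finsetSum _ _
    have h3 : ∀ᵐ x ∂P.μ, ∀ k, (a k • b k) x = a k * b k x := ae_all_iff.2 fun k => by
      filter_upwards [Lp.coeFn_smul (a k) (b k)] with x hx
      simpa using hx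
    filter_upwards [h1, h2, h3, P.app_ae_eq f] with x h1 h2 h3 h4
    rw [h1, Pi.sub_apply, h2, Finset.sum_apply, ← h4]
    simp only [h3]
    ring
  have hz : ‖z‖ ≤ r := h f hf
  have hmain : ∫⁻ ω, ‖P.app f - ∑ k, S.apply (P.eval f) ω k • b k‖ₑ ^ 2 ∂S.prob ≤
      ENNReal.ofReal ((√(1 + q) * r) ^ 2) := by
    calc _ = ∫⁻ ω, (ENNReal.ofReal (‖z‖ ^ 2) + ENNReal.ofReal
          (∑ k, ‖S.apply (fun x => ∑ k, a k * b k x + g x) ω k - a k‖ ^ 2)) ∂S.prob := by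
          refine lintegral_congr_ae ?_
          filter_upwards [P.apply_congr S hdecomp] with ω hω
          rw [← ENNReal.ofReal_add (by positivity) (by positivity), ← hω,
            ← hb.norm_sub_sum_sq (P.app f), ENNReal.ofReal_pow (norm_nonneg _), ofReal_norm]
      _ ≤ ENNReal.ofReal (‖z‖ ^ 2) + ENNReal.ofReal (q * ∫ x, ‖g x‖ ^ 2 ∂P.μ) := by
          rw [lintegral_add_left measurable_const]
          simp only [lintegral_const, measure_univ, mul_one]
          gcongr
          exact hS a g hgm hg2 horth
      _ ≤ _ := by
          rw [hgsq, ← ENNReal.ofReal_add (by positivity) (by positivity)]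
          apply ENNReal.ofReal_le_ofReal
          rw [mul_pow, Real.sq_sqrt (by positivity)]
          have : ‖z‖ ^ 2 ≤ r ^ 2 := by gcongr
          nlinarith
  calc _ ≤ ENNReal.ofReal ((√(1 + q) * r) ^ 2) ^ (1 / 2 : ℝ) := by gcongr
    _ = _ := by
        rw [ENNReal.ofReal_rpow_of_nonneg (by positivity) (by norm_num), ← Real.sqrt_eq_rpow,
          Real.sqrt_sq (by positivity)]

theorem exists_orthonormal_of_worMinError_lt (P : ApproxProblem.{u} 𝕜 d) {n : ℕ} (hn : 0 < n)
    {R : ℝ≥0∞} (hR : P.worMinError P.allInfo n < R) :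
    ∃ (m : ℕ) (b : Fin m → P.G) (r : ℝ), m ≤ n ∧ Orthonormal 𝕜 b ∧ 0 ≤ r ∧
      ENNReal.ofReal r ≤ R ∧
      ∀ f : P.F, ‖f‖ ≤ 1 → ‖P.app f - ∑ k, inner 𝕜 (b k) (P.app f) • b k‖ ≤ r := by
  obtain ⟨n, rfl⟩ := Nat.exists_eq_add_one_of_ne_zero hn.ne'
  simp only [worMinError, iInf_lt_iff] at hR
  obtain ⟨L, -, φ, -, hlt⟩ := hR
  set w := P.worError L φ with hw
  have hwtop : w ≠ ⊤ := hlt.ne_top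
  have hbound : ∀ f : P.F, ‖f‖ ≤ 1 → ‖P.app f - φ (fun i => L i f)‖ ≤ w.toReal := by
    intro f hf
    rw [← toReal_enorm]
    exact ENNReal.toReal_mono hwtop
      (le_iSup₂ (f := fun (f : P.F) (_ : ‖f‖ ≤ 1) => ‖P.app f - φ (fun i => L i f)‖ₑ) f hf)
  -- Both `f` and `-f` yield zero information and hence the same output, which is within `w` of both
  -- images; these are `2 ‖P.app f‖` apart.
  have hzero : ∀ f : P.F, ‖f‖ ≤ 1 → (∀ i, L i f = 0) → ‖P.app f‖ ≤ w.toReal := by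
    intro f hf hL
    have h1 := hbound f hf
    have h2 := hbound (-f) (by rwa [norm_neg])
    simp only [map_neg, hL, neg_zero] at h1 h2
    have h3 := norm_sub_le (P.app f - φ fun _ => 0) (-P.app f - φ fun _ => 0)
    have h4 : (P.app f - φ fun _ => 0) - (-P.app f - φ fun _ => 0) = (2 : ℝ) • P.app f := by
      rw [two_smul]; abel
    rw [h4, norm_smul, Real.norm_ofNat] at h3
    linarith
  obtain ⟨V, hV, hdim, hdist⟩ := exists_submodule_norm_sub_le P.app P.continuous_app L
    ENNReal.toReal_nonneg hzero
  let e := stdOrthonormalBasis 𝕜 V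
  have hb : Orthonormal 𝕜 fun k => (e k : P.G) := e.orthonormal.comp_linearIsometry V.subtypeₗᵢ
  refine ⟨_, fun k => (e k : P.G), w.toReal, hdim, hb, ENNReal.toReal_nonneg, ?_, ?_⟩
  · rw [ENNReal.ofReal_toReal hwtop]; exact hlt.le
  · intro f hf
    obtain ⟨v, hv, hle⟩ := hdist f hf
    have hrepr : v = ∑ k, e.repr ⟨v, hv⟩ k • (e k : P.G) := by
      have := congrArg (Subtype.val) (e.sum_repr ⟨v, hv⟩)
      simpa using this.symm
    have := hb.norm_sub_sum_sq (P.app f) (fun k => e.repr ⟨v, hv⟩ k)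
    rw [← hrepr] at this
    refine le_trans (pow_le_pow_iff_left₀ (norm_nonneg _) (norm_nonneg _) two_ne_zero |>.1 ?_) hle
    rw [this]
    exact le_add_of_nonneg_right (by positivity)

/-- The randomized error with function values is bounded by the worst case error with arbitrary
linear information, up to a factor `√(1 + q)`. -/
theorem ranMinError_le_worMinError (P : ApproxProblem.{u} 𝕜 d) {n N : ℕ} (hn : 0 < n)
    (hN : 0 < N) {q : ℝ} (hq : 0 < q) (j : ℕ → ℕ)
    (hjN : ∀ m, 0 < m → m ≤ n → m + ⌈2 * m * (Real.log m + 1)⌉₊ + j m ≤ N)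
    (hjq : ∀ m : ℕ, 0 < m → m ≤ n → (2 * m / (2 * m + j m) : ℝ) ≤ q) :
    P.ranMinError P.stdInfo N ≤
      ENNReal.ofReal (√(1 + q)) * P.worMinError P.allInfo n := by
  have hs : ENNReal.ofReal (√(1 + q)) ≠ 0 := by
    rw [Ne, ENNReal.ofReal_eq_zero, not_le]; positivity
  rw [mul_comm, ← ENNReal.div_le_iff hs ENNReal.ofReal_ne_top]
  -- The infimum defining the worst case error need not be attained, so it is approached from
  -- strictly above.
  refine le_of_forall_gt fun R hR => ?_
  obtain ⟨R', hR1, hR2⟩ := exists_between hR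
  refine lt_of_le_of_lt ?_ hR2
  rw [ENNReal.div_le_iff hs ENNReal.ofReal_ne_top]
  obtain ⟨m, b, r, hm, hb, hr, hrR, hdist⟩ := P.exists_orthonormal_of_worMinError_lt hn hR1
  have hη := P.isOrthonormalSystem hb
  have : P.ranMinError P.stdInfo N ≤ ENNReal.ofReal (√(1 + q) * r) := by
    -- For `m = 0` the subspace is trivial, and a sampler without points has error zero.
    rcases Nat.eq_zero_or_pos m with rfl | hpos
    · obtain ⟨S, hS⟩ := exists_interpolationSampler hη
      exact P.ranMinError_le_of_hasError hb hq.le (hS.mono (by simpa using hq.le)) hr hdist hN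
        hN.le
    · obtain ⟨S, hS⟩ := exists_sampler_decreasingStep hpos hη (j m)
      exact P.ranMinError_le_of_hasError hb hq.le (hS.mono (hjq m hpos hm)) hr hdist hN
        (hjN m hpos hm)
  refine this.trans ?_
  rw [ENNReal.ofReal_mul (Real.sqrt_nonneg _), mul_comm]
  gcongr

end ApproxProblem

/-! ### Information complexity -/

/-- A finite infimum of natural numbers is attained. -/
theorem le_of_infoComplexity_eq {e : ℕ → ℝ≥0∞} {c : ErrorCriterion} {ε : ℝ} {n : ℕ}
    (h : infoComplexity e c ε = n) : e n ≤ ENNReal.ofReal ε * c.cri e := by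
  have hlt : infoComplexity e c ε < ((n + 1 : ℕ) : ℕ∞) := by
    rw [h]; exact_mod_cast n.lt_succ_self
  obtain ⟨k, hk, hkn⟩ : ∃ k : ℕ, ∃ _ : e k ≤ ENNReal.ofReal ε * c.cri e,
      (k : ℕ∞) < ((n + 1 : ℕ) : ℕ∞) := by
    simpa only [infoComplexity, iInf_lt_iff] using hlt
  have h1 : infoComplexity e c ε ≤ k := iInf₂_le k hk
  rw [h] at h1
  have h2 : n ≤ k := by exact_mod_cast h1
  have h3 : k < n + 1 := by exact_mod_cast hkn
  obtain rfl : n = k := by omega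
  exact hk

namespace ApproxProblem

variable {𝕜 : Type v} [RCLike 𝕜] {d : ℕ}

/-- The common form of both parts, with `κ` equal to `4` or `A_δ`. The initial errors of the two
settings coincide, so both criteria are treated at once. The subspace may have any dimension `m ≤
n`; monotonicity of `j` bounds its cost by that of `n`. -/
theorem nRanStd_le (P : ApproxProblem.{u} 𝕜 d) (c : ErrorCriterion) {ε κ q C ω : ℝ} (hε : 0 < ε)
    (hκ : 1 ≤ κ) (hq : 0 < q) (hqκ : √(1 + q) ≤ κ) (hC : 0 < C) (hω : 0 < ω) (j : ℕ → ℕ)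
    (hj : Monotone j) (hjq : ∀ m : ℕ, 0 < m → (2 * m / (2 * m + j m) : ℝ) ≤ q)
    (hjC : ∀ n : ℕ, 0 < n → (n + ⌈2 * n * (Real.log n + 1)⌉₊ + j n : ℝ) ≤
      C * (n + 1 : ℝ) ^ (1 + ω)) :
    (P.nRanStd c ε : ℝ≥0∞) ≤
      ENNReal.ofReal C * ((P.nWorAll c (ε / κ) : ℝ≥0∞) + 1) ^ (1 + ω) := by
  have hcri : c.cri (P.worMinError P.allInfo) = c.cri (P.ranMinError P.stdInfo) := by
    cases c <;> rfl
  have hεκ : ε / κ ≤ ε := div_le_self hε.le hκ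
  rcases eq_or_ne (P.nWorAll c (ε / κ)) ⊤ with htop | htop
  · rw [htop, ENat.toENNReal_top, top_add, ENNReal.top_rpow_of_pos (by linarith),
      ENNReal.mul_top (by simpa using hC)]
    exact le_top
  obtain ⟨n, hn⟩ := ENat.ne_top_iff_exists.1 htop
  have hle := le_of_infoComplexity_eq hn.symm
  rw [hcri] at hle
  rw [← hn]
  -- For `n = 0` the zero algorithm already suffices in both settings.
  rcases Nat.eq_zero_or_pos n with rfl | hpos
  · have hran : P.ranMinError P.stdInfo 0 ≤
        ENNReal.ofReal ε * c.cri (P.ranMinError P.stdInfo) := by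
      refine (show P.ranMinError P.stdInfo 0 = P.worMinError P.allInfo 0 from rfl).le.trans
        (hle.trans ?_)
      gcongr
    have h0 : P.nRanStd c ε ≤ ((0 : ℕ) : ℕ∞) := iInf₂_le 0 hran
    have h1 : P.nRanStd c ε = 0 := by simpa using h0
    simp [h1]
  · set N := n + ⌈2 * n * (Real.log n + 1)⌉₊ + j n with hN
    have hNpos : 0 < N := by omega
    have hran := P.ranMinError_le_worMinError hpos hNpos hq j (fun m hm hmn => by
      have h1 : (1 : ℝ) ≤ m := by exact_mod_cast hm
      have h2 : (m : ℝ) ≤ n := by exact_mod_cast hmn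
      have h3 : 0 ≤ Real.log m := Real.log_nonneg h1
      have h4 : ⌈2 * m * (Real.log m + 1)⌉₊ ≤ ⌈2 * n * (Real.log n + 1)⌉₊ := by
        apply Nat.ceil_mono
        gcongr
      have := hj hmn
      omega) (fun m hm _ => hjq m hm)
    have h1 : P.nRanStd c ε ≤ (N : ℕ∞) := by
      refine iInf₂_le N (hran.trans ?_)
      calc _ ≤ ENNReal.ofReal κ * (ENNReal.ofReal (ε / κ) *
            c.cri (P.ranMinError P.stdInfo)) := by gcongr
        _ = _ := by
            rw [← mul_assoc, ← ENNReal.ofReal_mul (by linarith),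
              mul_div_cancel₀ _ (by linarith)]
    calc (P.nRanStd c ε : ℝ≥0∞) ≤ ((N : ℕ∞) : ℝ≥0∞) := ENat.toENNReal_mono h1
      _ = ENNReal.ofReal N := by simp
      _ ≤ ENNReal.ofReal (C * (n + 1 : ℝ) ^ (1 + ω)) := by
          apply ENNReal.ofReal_le_ofReal
          rw [hN]; push_cast
          exact hjC n hpos
      _ = _ := by
          rw [ENNReal.ofReal_mul hC.le, ← ENNReal.ofReal_rpow_of_pos (by positivity),
            ENNReal.ofReal_add (by positivity) (by positivity)]
          simp

end ApproxProblem

/-! ### The constants and the final estimate -/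

/-- Boundedness follows from `log x ≤ x ^ ω / ω` and `1 ≤ x ^ ω`. -/
theorem exists_isLUB_log_div_rpow {ω : ℝ} (hω : 0 < ω) (F : ℝ → ℝ) {A B : ℝ} (hA : 0 ≤ A)
    (hF : ∀ x, 1 ≤ x → F x ≤ A * Real.log x + B) :
    ∃ C, IsLUB ((fun x => F x / x ^ ω) '' Set.Ici 1) C := by
  refine Real.exists_isLUB ⟨_, Set.mem_image_of_mem _ (Set.mem_Ici.2 le_rfl)⟩
    ⟨A * (1 / ω) + |B|, ?_⟩
  rintro _ ⟨x, hx, rfl⟩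
  have hx : (1 : ℝ) ≤ x := hx
  have hpow : 1 ≤ x ^ ω := Real.one_le_rpow hx hω.le
  have hlog := Real.log_le_rpow_div (by linarith : 0 ≤ x) hω
  have hB : B ≤ |B| * x ^ ω := by nlinarith [le_abs_self B, abs_nonneg B]
  have hA' : A * Real.log x ≤ A * (x ^ ω / ω) := by gcongr
  show F x / x ^ ω ≤ _
  rw [div_le_iff₀ (by linarith)]
  calc F x ≤ A * Real.log x + B := hF x hx
    _ ≤ A * (x ^ ω / ω) + |B| * x ^ ω := add_le_add hA' hB
    _ = _ := by ring

theorem mul_le_of_isLUB_div_rpow {ω C : ℝ} {F : ℝ → ℝ}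
    (hC : IsLUB ((fun x => F x / x ^ ω) '' Set.Ici 1) C) {x : ℝ} (hx : 1 ≤ x) :
    F x * x ≤ C * x ^ (1 + ω) := by
  have hpos : 0 < x := by linarith
  have h := hC.1 (Set.mem_image_of_mem _ (Set.mem_Ici.2 hx))
  have h' : F x / x ^ ω ≤ C := h
  rw [div_le_iff₀ (Real.rpow_pos_of_pos hpos _)] at h'
  rw [Real.rpow_add hpos, Real.rpow_one]
  nlinarith

theorem corollary2p4 (𝕜 : Type v) [RCLike 𝕜] :
    (∀ ω : ℝ, 0 < ω → ∃ C : ℝ,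
      IsLUB ((fun x : ℝ => 96 * √2 * (Real.log x + Real.log (192 * √2)) / x ^ ω) '' Set.Ici 1) C ∧
      ∀ (d : ℕ) (APP : ApproxProblem.{u} 𝕜 d) (c : ErrorCriterion) (ε : ℝ), 0 < ε →
        (APP.nRanStd c ε : ℝ≥0∞) ≤
          ENNReal.ofReal C * ((APP.nWorAll c (ε / 4) : ℝ≥0∞) + 1) ^ (1 + ω)) ∧
    (∃ δ₀ : ℝ, 0 < δ₀ ∧ δ₀ < 1 ∧ ∀ δ : ℝ, 0 < δ → δ < δ₀ → ∀ ω : ℝ, 0 < ω → ∃ C : ℝ,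
      IsLUB ((fun x : ℝ => 48 * (4 * (Real.log 48 + Real.log (Real.log (1 / δ)) + Real.log x) +
        Real.log (1 / δ)) / x ^ ω) '' Set.Ici 1) C ∧
      ∀ (d : ℕ) (APP : ApproxProblem.{u} 𝕜 d) (c : ErrorCriterion) (ε : ℝ), 0 < ε →
        (APP.nRanStd c ε : ℝ≥0∞) ≤
          ENNReal.ofReal C * ((APP.nWorAll c (ε / constA δ) : ℝ≥0∞) + 1) ^ (1 + ω)) := by
  have hlog1 : ∀ y : ℝ, 3 ≤ y → 1 ≤ Real.log y := fun y hy => by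
    rw [Real.le_log_iff_exp_le (by linarith)]
    linarith [Real.exp_one_lt_d9]
  have hlogsucc : ∀ n : ℕ, 0 < n → 0 ≤ Real.log n ∧ Real.log n ≤ Real.log (n + 1) := by
    intro n hn
    have hn1 : (1 : ℝ) ≤ n := by exact_mod_cast hn
    exact ⟨Real.log_nonneg hn1, Real.log_le_log (by linarith) (by linarith)⟩
  have hceil : ∀ n : ℕ, 0 < n → (n + ⌈2 * n * (Real.log n + 1)⌉₊ : ℝ) ≤
      (n + 1) * (2 * Real.log (n + 1) + 3) := by
    intro n hn
    obtain ⟨h0, h1⟩ := hlogsucc n hn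
    have h2 := Nat.ceil_lt_add_one (a := 2 * n * (Real.log n + 1)) (by positivity)
    have h3 : 2 * (n : ℝ) * (Real.log n + 1) ≤ 2 * (n + 1) * (Real.log (n + 1) + 1) - 2 := by
      have hn0 : (0 : ℝ) ≤ n := by positivity
      nlinarith
    nlinarith
  have hsqrt : 1 ≤ √2 := Real.one_le_sqrt.2 one_le_two
  constructor
  · intro ω hω
    have hl := hlog1 (192 * √2) (by linarith)
    obtain ⟨C, hC⟩ := exists_isLUB_log_div_rpow hω
      (fun x => 96 * √2 * (Real.log x + Real.log (192 * √2)))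
      (A := 96 * √2) (B := 96 * √2 * Real.log (192 * √2)) (by positivity)
      (fun x _ => (mul_add _ _ _).le)
    refine ⟨C, hC, fun d APP c ε hε => ?_⟩
    have hCpos : 0 < C := by
      have := mul_le_of_isLUB_div_rpow hC le_rfl
      simp only [Real.log_one, zero_add, mul_one, Real.one_rpow] at this
      nlinarith
    -- Without decreasing steps `q = 1`.
    refine APP.nRanStd_le c hε (by norm_num) one_pos ?_ hCpos hω (fun _ => 0) monotone_const
      ?_ ?_
    · rw [Real.sqrt_le_left (by norm_num)]; norm_num
    · intro m hm
      have : (0 : ℝ) < m := by exact_mod_cast hm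
      rw [Nat.cast_zero, add_zero, div_self (by positivity)]
    · intro n hn
      obtain ⟨h0, h1⟩ := hlogsucc n hn
      have hx : (1 : ℝ) ≤ n + 1 := by linarith [(Nat.cast_nonneg n : (0 : ℝ) ≤ n)]
      refine le_trans ?_ (mul_le_of_isLUB_div_rpow hC hx)
      rw [Nat.cast_zero, add_zero]
      refine (hceil n hn).trans ?_
      rw [mul_comm]
      gcongr
      nlinarith
  -- The choice `δ₀ = 1/e` ensures `ℓ ≥ 1`, so that `log ℓ ≥ 0`.
  · refine ⟨Real.exp (-1), Real.exp_pos _, by simp, fun δ hδ hδ1 ω hω => ?_⟩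
    have hδ' : δ < 1 := hδ1.trans (by simp)
    set ℓ := Real.log (1 / δ) with hℓ
    have hℓ1 : 1 ≤ ℓ := by
      rw [hℓ, one_div, Real.log_inv, le_neg]
      exact (Real.log_le_iff_le_exp hδ).2 hδ1.le
    have hℓ0 : 0 ≤ Real.log ℓ := Real.log_nonneg hℓ1
    have h48 := hlog1 48 (by norm_num)
    obtain ⟨C, hC⟩ := exists_isLUB_log_div_rpow hω
      (fun x => 48 * (4 * (Real.log 48 + Real.log ℓ + Real.log x) + ℓ))
      (A := 192) (B := 48 * (4 * (Real.log 48 + Real.log ℓ) + ℓ)) (by norm_num)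
      (fun x _ => le_of_eq (by ring))
    refine ⟨C, hC, fun d APP c ε hε => ?_⟩
    have hCpos : 0 < C := by
      have := mul_le_of_isLUB_div_rpow hC le_rfl
      simp only [Real.log_one, add_zero, mul_one, Real.one_rpow] at this
      nlinarith
    -- The remaining factor `1 / √(1 - δ)` of `A_δ` is at least `1`.
    have hA : √(1 + 1 / (12 * ℓ)) ≤ constA δ := by
      refine le_mul_of_one_le_right (Real.sqrt_nonneg _) ?_
      rw [le_div_iff₀ (Real.sqrt_pos.2 (by linarith)), one_mul]
      exact Real.sqrt_le_one.2 (by linarith)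
    have hA1 : 1 ≤ constA δ := le_trans (Real.one_le_sqrt.2 (by
      have : 0 ≤ 1 / (12 * ℓ) := by positivity
      linarith)) hA
    -- With `j ≥ 24 ℓ m` the error `2m / (2m + j)` is at most `1 / (12 ℓ)`.
    refine APP.nRanStd_le c hε hA1 (q := 1 / (12 * ℓ)) (by positivity) hA hCpos hω
      (fun m => ⌈24 * ℓ * m⌉₊) ?_ ?_ ?_
    · intro m m' hmm
      apply Nat.ceil_mono
      have : (m : ℝ) ≤ m' := by exact_mod_cast hmm
      gcongr
    · intro m hm
      have hm0 : (0 : ℝ) < m := by exact_mod_cast hm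
      have := Nat.le_ceil (24 * ℓ * m)
      rw [div_le_div_iff₀ (by positivity) (by positivity)]
      nlinarith
    · intro n hn
      obtain ⟨h0, h1⟩ := hlogsucc n hn
      have hn0 : (0 : ℝ) ≤ n := Nat.cast_nonneg n
      have hx : (1 : ℝ) ≤ n + 1 := by linarith
      refine le_trans ?_ (mul_le_of_isLUB_div_rpow hC hx)
      have h2 := Nat.ceil_lt_add_one (a := 24 * ℓ * n) (by positivity)
      have h3 : (⌈24 * ℓ * n⌉₊ : ℝ) ≤ (n + 1) * (24 * ℓ) := by nlinarith
      refine (add_le_add (hceil n hn) h3).trans ?_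
      rw [← mul_add, mul_comm]
      gcongr
      nlinarith
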